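/- Let $C\ell_n$ be the Clifford algebra of Euclidean $\mathbb{R}^n$, with $vw+wv=-2(v,w)$, order involution $a\mapsto\tilde a$ ($\tilde v=-v$) and transpose $a\mapsto a^t$ ($v^t=v$). Let $\mathbb{R}^{n+1,1}\subset C\ell_n(2)$ be the space of matrices $\begin{pmatrix}x&\lambda\\ \mu&-x\end{pmatrix}$, $x\in\mathbb{R}^n$, $\lambda,\mu\in\mathbb{R}$, and let the Vahlen group consist of the invertible $g=\begin{pmatrix}a&b\\c&d\end{pmatrix}\in C\ell_n(2)$ with $g\,v\,\tilde g^{-1}\in\mathbb{R}^{n+1,1}$ for all $v\in\mathbb{R}^{n+1,1}$ and $g\bar g=1$, where $\tilde g=\begin{pmatrix}\tilde a&-\tilde b\\-\tilde c&\tilde d\end{pmatrix}$, $\bar g=\begin{pmatrix}d^t&-b^t\\-c^t&a^t\end{pmatrix}$. It acts on $\mathbb{R}^n\cup\{\infty\}$ by Möbius transformations, $g\cdot x=(ax+b)(cx+d)^{-1}$: that is, $v\mapsto gv\tilde g^{-1}$ followed by rescaling, on the light vectors $\begin{pmatrix}x&-x^2\\1&-x\end{pmatrix}$ and $\begin{pmatrix}0&1\\0&0\end{pmatrix}$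 that represent $x$ and $\infty$. Let $M$ be a smooth manifold and $f,\hat f:M\to\mathbb{R}^n$ smooth non-constant maps. A frame of $(f,\hat f)$ is a smooth map $F$ from $M$ to the Vahlen group with $F\cdot 0=f$ and $F\cdot\infty=\hat f$. Forms with values in $C\ell_n$ are wedged by multiplying coefficients in $C\ell_n$. The pair $(f,\hat f)$ is a Darboux pair if $g=\hat f-f$ has no zeros and $df\wedge g^{-1}\,d\hat f\,g^{-1}=0$. Theorem. Let $F$ frame $(f,\hat f)$, with $F^{-1}dF=\begin{pmatrix}\alpha&\beta\\ \gamma&\delta\end{pmatrix}$. Then $\beta$ and $\gamma$ take values in $\mathbb{R}^n$, and $(f,\hat f)$ is a Darboux pair if and only if $\beta\wedge\gamma=0$. Suppose moreover that $(f,\hat f)$ is a Darboux pair, that $M$ is a (connected) Riemann surface with a holomorphic quadratic differential $Q\not\equiv0$, and that $f$ is isothermic on $(M,Q)$: it is a conformal immersion and there is a smooth $f^c:M\to\mathbb{R}^n$, the Christoffel transform (unique up to translation), with $df\wedge df^c=0$ and $(df,df^c)^{2,0}=Q$. For $r\in\mathbb{R}^\times$ write $\hat f=\mathcal{D}_rf$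 if $\hat f$ is a Darboux transform of $f$ for which $g=\hat f-f$ solves $dg=r\,g\,df^c\,g-df$. Then, for every real $r$, $$r\neq0\ \text{ and }\ \hat f=\mathcal{D}_rf\quad\Longleftrightarrow\quad(\beta,\gamma)^{2,0}=-rQ .$$ Further, unless $f(M)$ lies in an affine $2$-plane or in a round $2$-sphere (of an affine $3$-space), there is exactly one $r\in\mathbb{R}^\times$ with $\hat f=\mathcal{D}_rf$; so then $\hat f=\mathcal{D}_rf$ with $r$ given by $(\beta,\gamma)^{2,0}=-rQ$. -/

import Mathlib

open scoped ContDiff Manifold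

universe u v w

noncomputable section

namespace DarbouxFrames

/-! ### The Clifford algebra of Euclidean space -/

/-- Euclidean `ℝⁿ`. -/
abbrev E (n : ℕ) : Type := EuclideanSpace ℝ (Fin n)

/-- The quadratic form `v ↦ -(v, v)` on `ℝⁿ`. -/
def negSq (n : ℕ) : QuadraticForm ℝ (E n) :=
  -(LinearMap.BilinMap.toQuadraticMap (innerₗ (E n)))

/-- The Clifford algebra `Cℓₙ` of `ℝⁿ`, with the sign convention `v w + w v = -2 (v, w)`. -/
abbrev Cl (n : ℕ) : Type := CliffordAlgebra (negSq n)

/-- The inclusion `ℝⁿ ⊂ Cℓₙ`. -/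
abbrev ι (n : ℕ) : E n →ₗ[ℝ] Cl n := CliffordAlgebra.ι (negSq n)

theorem ι_mul_add_mul (n : ℕ) (v w : E n) :
    ι n v * ι n w + ι n w * ι n v = algebraMap ℝ (Cl n) (-2 * inner ℝ v w) := by
  rw [CliffordAlgebra.ι_mul_ι_add_swap]
  congr 1
  simp only [QuadraticMap.polar, negSq, neg_apply,
    LinearMap.BilinMap.toQuadraticMap_apply, innerₗ_apply_apply, inner_add_left, inner_add_right,
    real_inner_comm v w]
  ring

theorem ι_injective (n : ℕ) : Function.Injective (ι n) := by
  intro v w h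
  have h0 : ι n (v - w) = 0 := by rw [map_sub, h, sub_self]
  have h1 := ι_mul_add_mul n (v - w) (v - w)
  rw [h0, mul_zero, add_zero] at h1
  have h2 : -2 * inner ℝ (v - w) (v - w) = (0 : ℝ) :=
    (algebraMap ℝ (Cl n)).injective (by rw [← h1, map_zero])
  exact sub_eq_zero.1 (inner_self_eq_zero (𝕜 := ℝ).1 (by simpa using h2))

/-- The vector of `ℝⁿ` that an element of `ℝⁿ ⊂ Cℓₙ` is (and an irrelevant value elsewhere). -/
def toVec (n : ℕ) : Cl n → E n := Function.invFun (ι n)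

theorem toVec_ι (n : ℕ) (v : E n) : toVec n (ι n v) = v :=
  Function.leftInverse_invFun (ι_injective n) v

/-- A linear coordinate system on the finite-dimensional space `Cℓₙ`. -/
def clCoord (n : ℕ) : Cl n ≃ₗ[ℝ] (Finset (Fin n) → ℝ) :=
  (CliffordAlgebra.equivExterior (negSq n)).trans
    (EuclideanSpace.basisFun (Fin n) ℝ).toBasis.ExteriorAlgebra.equivFun

/- `Cℓₙ` is a finite-dimensional real vector space, so its smooth structure does not depend on
the choice of a norm; we use the sup norm of coordinates. -/
instance (n : ℕ) : NormedAddCommGroup (Cl n) :=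
  NormedAddCommGroup.induced (Cl n) (Finset (Fin n) → ℝ) (clCoord n) (clCoord n).injective

instance (n : ℕ) : NormedSpace ℝ (Cl n) :=
  NormedSpace.induced ℝ (Cl n) (Finset (Fin n) → ℝ) (clCoord n)

/-- The order involution `a ↦ ã`, with `ṽ = -v` on vectors. -/
abbrev ord {n : ℕ} (a : Cl n) : Cl n := CliffordAlgebra.involute a

/-- The transpose anti-involution `a ↦ aᵗ`, with `vᵗ = v` on vectors. -/
abbrev tr {n : ℕ} (a : Cl n) : Cl n := CliffordAlgebra.reverse a

/-! ### Vahlen matrices -/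

/-- The algebra `Cℓₙ(2)`, which is the Clifford algebra `Cℓₙ₊₁,₁` of the space of
vectors `lorVec x l m`. -/
abbrev Mat (n : ℕ) : Type := Matrix (Fin 2) (Fin 2) (Cl n)

/-- The vector `(x, l; m, -x)` of `ℝⁿ⁺¹'¹ ⊂ Cℓₙ(2)`; its square is `-((x, x) - l m)`
times the identity, so that the inner product of these vectors has signature `(n + 1, 1)`. -/
def lorVec {n : ℕ} (x : E n) (l m : ℝ) : Mat n :=
  !![ι n x, algebraMap ℝ (Cl n) l; algebraMap ℝ (Cl n) m, -ι n x]

/-- The space `ℝⁿ⁺¹'¹ ⊂ Cℓₙ(2)`. -/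
def lor (n : ℕ) : Set (Mat n) := {v | ∃ (x : E n) (l m : ℝ), v = lorVec x l m}

/-- The order involution of `Cℓₙ(2) = Cℓₙ₊₁,₁`. -/
def matOrd {n : ℕ} (g : Mat n) : Mat n :=
  !![ord (g 0 0), -ord (g 0 1); -ord (g 1 0), ord (g 1 1)]

/-- The conjugate anti-involution of `Cℓₙ(2) = Cℓₙ₊₁,₁`. -/
def matConj {n : ℕ} (g : Mat n) : Mat n :=
  !![tr (g 1 1), -tr (g 0 1); -tr (g 1 0), tr (g 0 0)]

/- `matOrd` and `matConj` are the (anti-)automorphisms that are `-1` on vectors. -/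
theorem matOrd_lorVec {n : ℕ} (x : E n) (l m : ℝ) : matOrd (lorVec x l m) = -lorVec x l m := by
  ext i j; fin_cases i <;> fin_cases j <;> simp [matOrd, lorVec]

theorem matConj_lorVec {n : ℕ} (x : E n) (l m : ℝ) : matConj (lorVec x l m) = -lorVec x l m := by
  ext i j; fin_cases i <;> fin_cases j <;> simp [matConj, lorVec]

theorem matOrd_mul {n : ℕ} (g h : Mat n) : matOrd (g * h) = matOrd g * matOrd h := by
  ext i j; fin_cases i <;> fin_cases j <;> simp [matOrd, Matrix.mul_apply] <;> abel

theorem matConj_mul {n : ℕ} (g h : Mat n) : matConj (g * h) = matConj h * matConj g := by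
  ext i j; fin_cases i <;> fin_cases j <;> simp [matConj, Matrix.mul_apply] <;> abel

/-- The twisted adjoint action `v ↦ g v g̃⁻¹`. -/
def twistedAd {n : ℕ} (g v : Mat n) : Mat n := g * v * Ring.inverse (matOrd g)

/-- Membership in the Vahlen group: `g` lies in the Clifford group of `ℝⁿ⁺¹'¹` (it is invertible
and its twisted adjoint action preserves `ℝⁿ⁺¹'¹`) and has norm `N(g) = g ḡ = 1`. -/
structure IsVahlen {n : ℕ} (g : Mat n) : Prop where
  isUnit : IsUnit g
  preserves : ∀ v ∈ lor n, twistedAd g v ∈ lor n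
  norm_eq_one : g * matConj g = 1

/-- Inverse stereographic projection of `ℝⁿ ∪ {∞}` into the light cone:
`x ↦ (x, -x²; 1, -x)`, where `-x² = (x, x)`, and `∞ ↦ (0, 1; 0, 0)`. -/
def lightLift {n : ℕ} (x : OnePoint (E n)) : Mat n :=
  x.elim (lorVec 0 1 0) (fun v => lorVec v (inner ℝ v v) 1)

/-- `g · x = y` for the Möbius action on `ℝⁿ ∪ {∞}`: the linear action on light vectors followed
by rescaling. -/
def MapsTo {n : ℕ} (g : Mat n) (x y : OnePoint (E n)) : Prop :=
  ∃ l : ℝ, l ≠ 0 ∧ twistedAd g (lightLift x) = l • lightLift y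

/-! ### Forms on a manifold `M` modelled on a real normed space `T` -/

section Forms

variable {T : Type*} [NormedAddCommGroup T] [NormedSpace ℝ T]
  {M : Type*} [TopologicalSpace M] [ChartedSpace T M]
  {V : Type*} [NormedAddCommGroup V] [NormedSpace ℝ V]

/-- Smooth maps from `M` to a real normed space. -/
abbrev Smooth (T : Type*) [NormedAddCommGroup T] [NormedSpace ℝ T]
    {M : Type*} [TopologicalSpace M] [ChartedSpace T M]
    {V : Type*} [NormedAddCommGroup V] [NormedSpace ℝ V] (f : M → V) : Prop :=
  ContMDiff 𝓘(ℝ, T) 𝓘(ℝ, V) ∞ f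

/-- The differential of a map `f : M → V`. -/
def d (T : Type*) [NormedAddCommGroup T] [NormedSpace ℝ T]
    {M : Type*} [TopologicalSpace M] [ChartedSpace T M]
    {V : Type*} [NormedAddCommGroup V] [NormedSpace ℝ V]
    (f : M → V) (p : M) : TangentSpace 𝓘(ℝ, T) p →L[ℝ] V :=
  (NormedSpace.fromTangentSpace (f p)).toContinuousLinearMap ∘L mfderiv 𝓘(ℝ, T) 𝓘(ℝ, V) f p

/-- `α ∧ β = 0` for `Cℓₙ`-valued `1`-forms, multiplying coefficients in `Cℓₙ`. -/
def WedgeZero {n : ℕ} (α β : (p : M) → TangentSpace 𝓘(ℝ, T) p → Cl n) : Prop :=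
  ∀ (p : M) (X Y : TangentSpace 𝓘(ℝ, T) p), α p X * β p Y - α p Y * β p X = 0

/-- The Maurer–Cartan form `F⁻¹ dF` of a map `F : M → Cℓₙ(2)` into the invertible elements. -/
def maurerCartan (T : Type*) [NormedAddCommGroup T] [NormedSpace ℝ T]
    {M : Type*} [TopologicalSpace M] [ChartedSpace T M] {n : ℕ}
    (F : M → Mat n) (p : M) (X : TangentSpace 𝓘(ℝ, T) p) : Mat n :=
  Ring.inverse (F p) * Matrix.of fun i j => d T (fun q => F q i j) p X

/-- `F` is a (smooth) frame of the pair `(f, f')`: a map into the Vahlen group with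
`f = F · 0` and `f' = F · ∞`. -/
structure IsFrame (T : Type*) [NormedAddCommGroup T] [NormedSpace ℝ T]
    {M : Type*} [TopologicalSpace M] [ChartedSpace T M] {n : ℕ}
    (F : M → Mat n) (f f' : M → E n) : Prop where
  smooth : ∀ i j, Smooth T (fun p => F p i j)
  vahlen : ∀ p, IsVahlen (F p)
  zero : ∀ p, MapsTo (F p) ((0 : E n) : OnePoint (E n)) (f p)
  infty : ∀ p, MapsTo (F p) OnePoint.infty (f' p)

/-- `f` is not constant. -/
def NonConst {n : ℕ} (f : M → E n) : Prop := ∃ p q, f p ≠ f q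

/-- `(f, f')` is a Darboux pair: `f, f'` are smooth and non-constant, `g = f' - f` has no zeros,
and `df ∧ g⁻¹ df' g⁻¹ = 0`. -/
structure IsDarbouxPair (T : Type*) [NormedAddCommGroup T] [NormedSpace ℝ T]
    {M : Type*} [TopologicalSpace M] [ChartedSpace T M] {n : ℕ}
    (f f' : M → E n) : Prop where
  smooth : Smooth T f
  smooth' : Smooth T f'
  nonConst : NonConst f
  nonConst' : NonConst f'
  ne : ∀ p, f p ≠ f' p
  wedge : WedgeZero (T := T) (fun p X => ι n (d T f p X))
    (fun p X => Ring.inverse (ι n (f' p - f p)) * ι n (d T f' p X) *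
      Ring.inverse (ι n (f' p - f p)))

end Forms

/-! ### Polarised Riemann surfaces and isothermic surfaces -/

section Isothermic

variable {M : Type*} [TopologicalSpace M] [ChartedSpace ℂ M]

/-- The coordinate vector field `∂/∂z` of the chart `φ` of the Riemann surface `M` at the point with
coordinate `z`, as an element of the tangent space there, identified with `ℂ` by the preferred
chart at that point. -/
def coordField (φ : OpenPartialHomeomorph M ℂ) (z : ℂ) : ℂ :=
  let X : TangentSpace 𝓘(ℂ, ℂ) z := (1 : ℂ)
  let Y : TangentSpace 𝓘(ℂ, ℂ) (φ.symm z) := mfderiv 𝓘(ℂ, ℂ) 𝓘(ℂ, ℂ) φ.symm z X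
  Y

/-- A quadratic differential on a Riemann surface which is holomorphic and not identically zero,
that is, a polarisation. The tangent space at `p` is identified with `ℂ` by the preferred chart at
`p`, and the quadratic differential is `X ↦ coeff p * X ^ 2` there. Its coefficient in an arbitrary
chart is its value on the coordinate vector field `∂/∂z` of that chart. -/
structure Polarisation (M : Type*) [TopologicalSpace M] [ChartedSpace ℂ M] where
  coeff : M → ℂ
  holomorphic : ∀ φ ∈ atlas ℂ M, DifferentiableOn ℂ
    (fun z : ℂ => coeff (φ.symm z) * coordField φ z ^ 2) φ.target
  ne_zero : ∃ p, coeff p ≠ 0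

/-- The coefficient at `p` of the `(2,0)`-part of the symmetric product `(α, β)` of two
`ℝⁿ`-valued `1`-forms: the value of its complex bilinear extension on `(∂/∂z, ∂/∂z)`, where
`∂/∂z = (e - i J e) / 2` and `e = ∂/∂x = 1`, `J e = ∂/∂y = i` in the preferred chart at `p`. -/
def twoZero {n : ℕ} (α β : (p : M) → TangentSpace 𝓘(ℝ, ℂ) p → E n) (p : M) : ℂ :=
  let e : TangentSpace 𝓘(ℝ, ℂ) p := (1 : ℂ)
  let Je : TangentSpace 𝓘(ℝ, ℂ) p := Complex.I
  let h : TangentSpace 𝓘(ℝ, ℂ) p → TangentSpace 𝓘(ℝ, ℂ) p → ℝ := fun X Y =>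
    (inner ℝ (α p X) (β p Y) + inner ℝ (α p Y) (β p X)) / 2
  (((h e e - h Je Je) / 4 : ℝ) : ℂ) - ((h e Je / 2 : ℝ) : ℂ) * Complex.I

/-- `f` is a conformal immersion of the Riemann surface `M`. -/
structure IsConformalImmersion {n : ℕ} (f : M → E n) : Prop where
  smooth : Smooth ℂ f
  immersion : ∀ p, Function.Injective (d ℂ f p)
  conformal : ∀ p, twoZero (fun q X => d ℂ f q X) (fun q X => d ℂ f q X) p = 0

/-- `fc` is a Christoffel transform of `f` on `(M, Q)`: `df ∧ dfc = 0` and `(df, dfc)²'⁰ = Q`. -/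
structure IsChristoffel {n : ℕ} (Q : Polarisation M) (f fc : M → E n) : Prop where
  smooth : Smooth ℂ fc
  wedge : WedgeZero (T := ℂ) (fun p X => ι n (d ℂ f p X)) (fun p X => ι n (d ℂ fc p X))
  twoZero : ∀ p, twoZero (fun q X => d ℂ f q X) (fun q X => d ℂ fc q X) p = Q.coeff p

/-- `f : (M, Q) → ℝⁿ` is isothermic. -/
def IsIsothermic {n : ℕ} (Q : Polarisation M) (f : M → E n) : Prop :=
  IsConformalImmersion f ∧ ∃ fc : M → E n, IsChristoffel Q f fc

/-- `f' = 𝒟ᵣ f` for the isothermic surface `f : (M, Q) → ℝⁿ`: `f'` is a Darboux transform of `f`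
such that `g = f' - f` solves the Riccati equation `dg = r g dfc g - df`, with `r ≠ 0` and `fc` the
Christoffel transform of `f` (unique up to translation). -/
def IsDarbouxTransform {n : ℕ} (Q : Polarisation M) (r : ℝ) (f f' : M → E n) : Prop :=
  r ≠ 0 ∧ IsDarbouxPair ℂ f f' ∧ ∃ fc : M → E n, IsChristoffel Q f fc ∧
    ∀ (p : M) (X : TangentSpace 𝓘(ℝ, ℂ) p),
      ι n (d ℂ (fun q => f' q - f q) p X) =
        r • (ι n (f' p - f p) * ι n (d ℂ fc p X) * ι n (f' p - f p)) - ι n (d ℂ f p X)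

/-- The image of `f` lies in an affine `2`-plane or in a round `2`-sphere. -/
def InPlaneOrSphere {n : ℕ} (f : M → E n) : Prop :=
  (∃ A : AffineSubspace ℝ (E n), Module.finrank ℝ A.direction = 2 ∧ ∀ p, f p ∈ A) ∨
  (∃ (A : AffineSubspace ℝ (E n)) (c : E n) (ρ : ℝ), Module.finrank ℝ A.direction = 3 ∧
    c ∈ A ∧ 0 < ρ ∧ ∀ p, f p ∈ A ∧ dist (f p) c = ρ)

end Isothermic

end DarbouxFrames

end

open DarbouxFrames

namespace DarbouxFrames

/-! Write `F = (a, b; c, d)`, `g = f' - f` and `ω = g⁻¹ df' g⁻¹`. Since `F` sends `0` to `f` and `∞`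
to `f'`, `b = f d` and `a = f' c`. As the inverse of `F` is its conjugate, the derivatives of `c`
and `d` cancel from the off-diagonal entries of `F⁻¹ dF`, leaving `β = dᵗ df d` and `γ = -cᵗ df' c`.
The norm condition also forces `c = l⁻¹ g⁻¹ d̃`, where `l` is the nonzero real `d d̃ᵗ`. So with `L v
= dᵗ v d`, a similarity of `ℝⁿ` that multiplies inner products by `l²`, one has `β = L(df)` and `γ =
-l⁻² L(ω)` (`IsVahlen.shape`, `IsVahlen.exists_similarity`). Because `L v · L w = l dᵗ (v w) d̃`,
the equation `β ∧ γ = 0` is `df ∧ ω = 0`; because `L` is a similarity, `(β, γ)²'⁰ = -(df, ω)²'⁰`.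

If `f` is conformal, `df ∧ ω = 0` says that `ω = P dx + R dy` with `P = p f_x + q f_y` and `R = q
f_x - p f_y` (`eq_of_wedge_eq_zero`). Hence `ω` is determined by `(df, ω)²'⁰`. The Riccati equation
is the equation `ω = r df^c` (`riccati_iff`), so it amounts to `(df, ω)²'⁰ = r Q`. The value `r = 0`
would make `ω`, hence `df'`, vanish, and `f'` is not constant.

For the existence of `r`, the form `ω` is closed: in `dω = -g⁻¹ dg ∧ ω + ω ∧ dg g⁻¹` substitute `dg
= g ω g - df` and use `df ∧ ω = 0` and its transpose. Closedness of a form with coefficients `p`,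
`q` as above is `DualEq`. Its tangential part is the Cauchy–Riemann system for `(df, ω)²'⁰`, which
is therefore a holomorphic quadratic differential. Its normal part is a linear relation on the
trace-free second fundamental form. The forms `ω` and `df^c` give two such relations, independent
wherever the quotient of the two differentials is not real. If the quotient is real on an open set,
it is a real constant there, and the identity theorem makes it the constant `r` everywhere.
Otherwise `f` is umbilic on a dense set, hence everywhere (`umbilicAt_of_not_proportional`).

It remains that totally umbilic conformal immersions are plane or spherical. With conformal factor
`e^L`, the Codazzi equation gives `Δf = κ e^L (f - c)` with `κ ≤ 0` constant. A linear function `s`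
of `f - c` has a conserved energy `e^(-L) |ds|² - κ s² / 2`, a sum of nonnegative terms, so `s` is
constant as soon as its energy vanishes at one point. This produces the plane or sphere on one disc,
and also the unique continuation that carries it over `M`. -/

instance clFinite (n : ℕ) : Module.Finite ℝ (Cl n) := Module.Finite.equiv (clCoord n).symm

/-- One-sided inverses in `Cl n` are then two-sided, which is used below through `mul_eq_one_comm`.
-/
instance clNoetherian (n : ℕ) : IsNoetherianRing (Cl n) :=
  isNoetherian_of_tower ℝ (inferInstance : IsNoetherian ℝ (Cl n))

/-! ### Vectors in the Clifford algebra -/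

section Vectors

variable {n : ℕ}

theorem ι_mul_self (v : E n) : ι n v * ι n v = algebraMap ℝ (Cl n) (-inner ℝ v v) := by
  rw [CliffordAlgebra.ι_sq_scalar]
  rfl

theorem ι_mul_comm (v w : E n) :
    ι n v * ι n w = -(ι n w * ι n v) + (-2 * inner ℝ v w : ℝ) • 1 := by
  rw [← Algebra.algebraMap_eq_smul_one, ← ι_mul_add_mul]; abel

theorem ι_mul_self_smul (v : E n) : ι n v * ι n v = (-inner ℝ v v : ℝ) • 1 := by
  rw [ι_mul_self, Algebra.algebraMap_eq_smul_one]

theorem ι_mul_self_mul (v : E n) (a : Cl n) :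
    ι n v * (ι n v * a) = (-inner ℝ v v : ℝ) • a := by
  rw [← mul_assoc, ι_mul_self_smul, smul_one_mul]

theorem ι_mul_anticomm {v w : E n} (h : inner ℝ v w = (0 : ℝ)) :
    ι n v * ι n w = -(ι n w * ι n v) := by
  rw [ι_mul_comm, h]; simp

theorem ord_ι (v : E n) : ord (ι n v) = -ι n v := CliffordAlgebra.involute_ι v

theorem tr_ι (v : E n) : tr (ι n v) = ι n v := CliffordAlgebra.reverse_ι v

theorem tr_mul (a b : Cl n) : tr (a * b) = tr b * tr a := CliffordAlgebra.reverse.map_mul a b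

theorem ord_ord (a : Cl n) : ord (ord a) = a := CliffordAlgebra.involute_involute a

theorem tr_ord (a : Cl n) : tr (ord a) = ord (tr a) := CliffordAlgebra.reverse_involute a

theorem ord_mul (a b : Cl n) : ord (a * b) = ord a * ord b := map_mul _ a b

theorem ord_neg (a : Cl n) : ord (-a) = -ord a := map_neg _ a

theorem ord_smul (r : ℝ) (a : Cl n) : ord (r • a) = r • ord a := map_smul _ r a

theorem tr_neg (a : Cl n) : tr (-a) = -tr a := map_neg _ a

theorem tr_smul (r : ℝ) (a : Cl n) : tr (r • a) = r • tr a := map_smul _ r a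

theorem smul_one_injective {s t : ℝ} (h : s • (1 : Cl n) = t • 1) : s = t :=
  (algebraMap ℝ (Cl n)).injective (by simpa [Algebra.algebraMap_eq_smul_one] using h)

theorem eq_zero_of_ι_mul_eq_zero {v w : E n} (hv : v ≠ 0) (h : ι n v * ι n w = 0) : w = 0 := by
  have h1 := ι_mul_self_mul v (ι n w)
  rw [h, mul_zero, ← map_smul] at h1
  have h2 := ι_injective n ((map_zero (ι n)).trans h1)
  have h3 : -inner ℝ v v ≠ (0 : ℝ) := by simpa using hv
  exact (smul_eq_zero.1 h2.symm).resolve_left h3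

/-- Reflection form of the inverse: `g⁻¹ v g⁻¹` for a vector `g`. -/
noncomputable def invConj (g v : E n) : E n :=
  (inner ℝ g g : ℝ)⁻¹ • v - (2 * (inner ℝ g g : ℝ)⁻¹ ^ 2 * inner ℝ g v) • g

theorem ι_ringInverse {g : E n} (hg : g ≠ 0) :
    Ring.inverse (ι n g) = -((inner ℝ g g : ℝ)⁻¹ • ι n g) := by
  have h3 : (inner ℝ g g : ℝ) ≠ 0 := by simpa using hg
  have h1 : ι n g * -((inner ℝ g g : ℝ)⁻¹ • ι n g) = 1 := by
    rw [mul_neg, mul_smul_comm, ι_mul_self_smul, smul_smul, ← neg_smul, mul_neg,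
      neg_neg, inv_mul_cancel₀ h3, one_smul]
  have h2 : -((inner ℝ g g : ℝ)⁻¹ • ι n g) * ι n g = 1 := mul_eq_one_comm.1 h1
  exact Ring.inverse_unit (⟨_, _, h1, h2⟩ : (Cl n)ˣ)

theorem ι_mul_ι_mul_ι (g v : E n) :
    ι n g * ι n v * ι n g = (inner ℝ g g : ℝ) • ι n v - (2 * inner ℝ g v : ℝ) • ι n g := by
  rw [ι_mul_comm g v, add_mul, neg_mul, mul_assoc, ι_mul_self_smul, smul_one_mul, mul_smul_comm,
    mul_one]
  module

theorem ι_ringInverse_mul_self {g : E n} (hg : g ≠ 0) :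
    ι n g * Ring.inverse (ι n g) = 1 ∧ Ring.inverse (ι n g) * ι n g = 1 := by
  have h3 : (inner ℝ g g : ℝ) ≠ 0 := by simpa using hg
  have h1 : ι n g * Ring.inverse (ι n g) = 1 := by
    rw [ι_ringInverse hg, mul_neg, mul_smul_comm, ι_mul_self_smul, smul_smul, ← neg_smul,
      mul_neg, neg_neg, inv_mul_cancel₀ h3, one_smul]
  exact ⟨h1, mul_eq_one_comm.1 h1⟩

theorem ι_invConj {g : E n} (hg : g ≠ 0) (v : E n) :
    Ring.inverse (ι n g) * ι n v * Ring.inverse (ι n g) = ι n (invConj g v) := by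
  have h3 : (inner ℝ g g : ℝ) ≠ 0 := by simpa using hg
  rw [ι_ringInverse hg]
  simp only [neg_mul, mul_neg, smul_mul_assoc, mul_smul_comm]
  rw [ι_mul_ι_mul_ι, invConj, map_sub, map_smul, map_smul]
  match_scalars
  · field_simp
  · field_simp

theorem invConj_eq_zero {g v : E n} (hg : g ≠ 0) (h : invConj g v = 0) : v = 0 := by
  have h1 := ι_invConj hg v
  obtain ⟨h2, h3⟩ := ι_ringInverse_mul_self hg
  rw [h, map_zero] at h1
  apply ι_injective n
  have h4 : ι n v = ι n g * (Ring.inverse (ι n g) * ι n v * Ring.inverse (ι n g)) * ι n g := by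
    rw [mul_assoc _ (ι n v), ← mul_assoc (ι n g), h2, one_mul, mul_assoc, h3, mul_one]
  rw [h4, h1]; simp

/-- Two vector-valued covectors with vanishing wedge product, the first of which is conformal. -/
theorem eq_of_wedge_eq_zero {A B P R : E n} (hAB : inner ℝ A B = (0 : ℝ))
    (hE : (inner ℝ B B : ℝ) = inner ℝ A A) (hA : A ≠ 0)
    (h : ι n A * ι n R - ι n B * ι n P = 0) :
    P = (inner ℝ A P / inner ℝ A A : ℝ) • A + (inner ℝ A R / inner ℝ A A : ℝ) • B ∧
    R = (inner ℝ A R / inner ℝ A A : ℝ) • A - (inner ℝ A P / inner ℝ A A : ℝ) • B := by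
  have hE0 : (inner ℝ A A : ℝ) ≠ 0 := by simpa using hA
  have hBA : inner ℝ B A = (0 : ℝ) := by rw [real_inner_comm, hAB]
  -- The transposed equation is `R A = P B`; adding it to `A R = B P` leaves scalars.
  have hsym : inner ℝ A R = (inner ℝ B P : ℝ) := by
    have h1 : ι n R * ι n A - ι n P * ι n B = 0 := by
      have := congrArg tr h
      simpa [tr_mul] using this
    have h2 := ι_mul_comm A R
    have h3 := ι_mul_comm B P
    have h4 : (-2 * inner ℝ A R : ℝ) • (1 : Cl n) = (-2 * inner ℝ B P : ℝ) • 1 := by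
      rw [sub_eq_zero] at h h1
      rw [h, h3, h1] at h2
      exact (add_left_cancel h2).symm
    have := smul_one_injective h4
    linarith
  set p : ℝ := inner ℝ A P / inner ℝ A A with hp
  set q : ℝ := inner ℝ A R / inner ℝ A A with hq
  have hpE : inner ℝ A P = p * (inner ℝ A A : ℝ) := by rw [hp]; field_simp
  have hqE : inner ℝ A R = q * (inner ℝ A A : ℝ) := by rw [hq]; field_simp
  -- Subtract the expected tangential parts; the remainders still satisfy `A R' = B P'` and have to
  -- vanish.
  obtain ⟨P', hP'⟩ : ∃ P', P' = P - (p • A + q • B) := ⟨_, rfl⟩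
  obtain ⟨R', hR'⟩ : ∃ R', R' = R - (q • A - p • B) := ⟨_, rfl⟩
  have hAP : inner ℝ A P' = (0 : ℝ) := by
    simp only [hP', inner_sub_right, inner_add_right, inner_smul_right, hAB, hpE]; ring
  have hBP : inner ℝ B P' = (0 : ℝ) := by
    simp only [hP', inner_sub_right, inner_add_right, inner_smul_right, hBA, ← hsym, hqE, hE]; ring
  have hAR : inner ℝ A R' = (0 : ℝ) := by
    simp only [hR', inner_sub_right, inner_smul_right, hAB, hqE]; ring
  have h' : ι n A * ι n R' = ι n B * ι n P' := by
    rw [sub_eq_zero] at h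
    simp only [hP', hR', map_sub, map_add, map_smul, mul_sub, mul_add, mul_smul_comm, h,
      ι_mul_self_smul, hE, ι_mul_anticomm hBA]
    module
  have hER : (inner ℝ A A : ℝ) • ι n R' = -(ι n A * (ι n B * ι n P')) := by
    rw [← h', ι_mul_self_mul, neg_smul, neg_neg]
  have hBR : ι n B * ι n R' = ι n P' * ι n A := by
    have h1 : (inner ℝ A A : ℝ) • (ι n B * ι n R') = (inner ℝ A A : ℝ) • (ι n P' * ι n A) := by
      rw [← mul_smul_comm, hER, mul_neg, ← mul_assoc, ι_mul_anticomm hBA, neg_mul, neg_neg,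
        mul_assoc, ι_mul_self_mul, hE, mul_smul_comm, ι_mul_anticomm hAP, neg_smul, smul_neg,
        neg_neg]
    exact smul_right_injective _ hE0 h1
  -- The product `R' B` equals `A P'` by transposing `hBR`, and `-A P'` by substituting `hER`.
  have hP0 : P' = 0 := by
    apply eq_zero_of_ι_mul_eq_zero hA
    have h1 : ι n R' * ι n B = ι n A * ι n P' := by
      have := congrArg tr hBR
      simpa [tr_mul] using this
    have h2 : (inner ℝ A A : ℝ) • (ι n R' * ι n B) = (inner ℝ A A : ℝ) • -(ι n A * ι n P') := by
      rw [← smul_mul_assoc, hER, neg_mul, mul_assoc, mul_assoc,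
        ι_mul_anticomm (v := P') (w := B) (by rw [real_inner_comm, hBP]), mul_neg, mul_neg,
        neg_neg, ι_mul_self_mul, hE, mul_smul_comm, neg_smul, smul_neg]
    have h3 := smul_right_injective _ hE0 h2
    rw [h1, eq_neg_iff_add_eq_zero, ← two_smul ℝ] at h3
    exact (smul_eq_zero.1 h3).resolve_left two_ne_zero
  have hR0 : R' = 0 := by
    apply eq_zero_of_ι_mul_eq_zero hA
    rw [h', hP0]; simp
  exact ⟨sub_eq_zero.1 (hP'.symm.trans hP0), sub_eq_zero.1 (hR'.symm.trans hR0)⟩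

end Vectors

/-! ### Vahlen matrices that map `0` and `∞` to given points -/

section Vahlen

variable {n : ℕ}

theorem IsVahlen.ringInverse {g : Mat n} (hg : IsVahlen g) : Ring.inverse g = matConj g := by
  obtain ⟨u, hu⟩ := hg.isUnit
  have h1 := hg.norm_eq_one
  rw [← hu] at h1 ⊢
  rw [Ring.inverse_unit, ← mul_one (↑u⁻¹ : Mat n), ← h1, Units.inv_mul_cancel_left]

theorem IsVahlen.conj_mul {g : Mat n} (hg : IsVahlen g) : matConj g * g = 1 := by
  rw [← hg.ringInverse, Ring.inverse_mul_cancel _ hg.isUnit]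

theorem matOrd_one : matOrd (1 : Mat n) = 1 := by
  ext i j; fin_cases i <;> fin_cases j <;> simp [matOrd]

theorem IsVahlen.twistedAd_eq {g : Mat n} (hg : IsVahlen g) (v : Mat n) :
    twistedAd g v = g * v * matOrd (matConj g) := by
  have h1 : matOrd g * matOrd (matConj g) = 1 := by
    rw [← matOrd_mul, hg.norm_eq_one, matOrd_one]
  have h2 : matOrd (matConj g) * matOrd g = 1 := by
    rw [← matOrd_mul, hg.conj_mul, matOrd_one]
  rw [twistedAd]
  congr 1
  exact Ring.inverse_unit (⟨_, _, h1, h2⟩ : (Mat n)ˣ)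

/-- These are the two entries in the first column of the image of the light vector of `0`; together
they say `x = b d⁻¹`. -/
theorem MapsTo.zero_eqs {g : Mat n} (hg : IsVahlen g) {x : E n}
    (h : MapsTo g ((0 : E n) : OnePoint (E n)) x) :
    ∃ l : ℝ, l ≠ 0 ∧ g 1 1 * ord (tr (g 1 1)) = l • 1 ∧
      g 0 1 * ord (tr (g 1 1)) = l • ι n x := by
  obtain ⟨l, hl, h⟩ := h
  rw [hg.twistedAd_eq] at h
  refine ⟨l, hl, ?_, ?_⟩
  · simpa [lightLift, lorVec, matOrd, matConj, Matrix.mul_apply] using congrFun (congrFun h 1) 0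
  · simpa [lightLift, lorVec, matOrd, matConj, Matrix.mul_apply] using congrFun (congrFun h 0) 0

theorem MapsTo.infty_eqs {g : Mat n} (hg : IsVahlen g) {x : E n}
    (h : MapsTo g OnePoint.infty x) :
    ∃ l : ℝ, l ≠ 0 ∧ g 1 0 * ord (tr (g 1 0)) = l • 1 ∧
      g 0 0 * ord (tr (g 1 0)) = l • ι n x := by
  obtain ⟨l, hl, h⟩ := h
  rw [hg.twistedAd_eq] at h
  refine ⟨l, hl, ?_, ?_⟩
  · have := congrFun (congrFun h 1) 0
    simp [lightLift, lorVec, matOrd, matConj, Matrix.mul_apply] at this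
    exact this
  · have := congrFun (congrFun h 0) 0
    simp [lightLift, lorVec, matOrd, matConj, Matrix.mul_apply] at this
    exact this

theorem ord_ringInverse_ι {g : E n} (hg : g ≠ 0) :
    ord (Ring.inverse (ι n g)) = -Ring.inverse (ι n g) := by
  rw [ι_ringInverse hg, ord_neg, ord_smul, ord_ι, smul_neg]

theorem tr_ringInverse_ι {g : E n} (hg : g ≠ 0) :
    tr (Ring.inverse (ι n g)) = Ring.inverse (ι n g) := by
  rw [ι_ringInverse hg, tr_neg, tr_smul, tr_ι]

theorem eq_mul_of_mul_eq {a c u y : Cl n} {l : ℝ} (hl : l ≠ 0) (h1 : c * u = l • 1)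
    (h2 : a * u = l • y) : a = y * c := by
  have h3 : c * (l⁻¹ • u) = 1 := by rw [mul_smul_comm, h1, smul_smul, inv_mul_cancel₀ hl, one_smul]
  have h4 : (l⁻¹ • u) * c = 1 := mul_eq_one_comm.1 h3
  have h5 : a * (l⁻¹ • u) = y := by rw [mul_smul_comm, h2, smul_smul, inv_mul_cancel₀ hl, one_smul]
  rw [← h5, mul_assoc, h4, mul_one]

/-- The shape of a Vahlen matrix that maps `0` to `x` and `∞` to `y`. -/
theorem IsVahlen.shape {g : Mat n} (hg : IsVahlen g) {x y : E n}
    (h0 : MapsTo g ((0 : E n) : OnePoint (E n)) x) (h1 : MapsTo g OnePoint.infty y) :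
    x ≠ y ∧ g 0 0 = ι n y * g 1 0 ∧ g 0 1 = ι n x * g 1 1 ∧
    ∃ l : ℝ, l ≠ 0 ∧ g 1 1 * ord (tr (g 1 1)) = l • 1 ∧ ord (tr (g 1 1)) * g 1 1 = l • 1 ∧
      g 1 0 = l⁻¹ • (Ring.inverse (ι n (y - x)) * ord (g 1 1)) := by
  obtain ⟨l, hl, hd, hb⟩ := MapsTo.zero_eqs hg h0
  obtain ⟨m, hm, hc, ha⟩ := MapsTo.infty_eqs hg h1
  have ha' := eq_mul_of_mul_eq hm hc ha
  have hb' := eq_mul_of_mul_eq hl hd hb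
  have hd' : ord (tr (g 1 1)) * g 1 1 = l • 1 := by
    have : (l⁻¹ • ord (tr (g 1 1))) * g 1 1 = 1 := mul_eq_one_comm.1 (by
      rw [mul_smul_comm, hd, smul_smul, inv_mul_cancel₀ hl, one_smul])
    rw [← this, smul_mul_assoc, smul_smul, mul_inv_cancel₀ hl, one_smul]
  have e1 : g 0 0 * tr (g 1 1) - g 0 1 * tr (g 1 0) = 1 := by
    have := congrFun (congrFun hg.norm_eq_one 0) 0
    simpa [matConj, Matrix.mul_apply, sub_eq_add_neg] using this
  have e2 : g 1 0 * tr (g 1 1) - g 1 1 * tr (g 1 0) = 0 := by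
    have := congrFun (congrFun hg.norm_eq_one 1) 0
    simpa [matConj, Matrix.mul_apply, sub_eq_add_neg] using this
  -- The norm condition reads `a dᵗ - b cᵗ = 1` and `c dᵗ = d cᵗ`; with `a = y c` and `b = x d` it
  -- becomes `(y - x) c dᵗ = 1`. This separates `x` from `y` and determines `c`.
  have e3 : ι n (y - x) * (g 1 0 * tr (g 1 1)) = 1 := by
    rw [← e1, ha', hb', map_sub, sub_mul, mul_assoc, mul_assoc, sub_eq_zero.1 e2]
  have hxy : x ≠ y := by
    rintro rfl
    simp at e3
  refine ⟨hxy, ha', hb', l, hl, hd, hd', ?_⟩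
  obtain ⟨i1, i2⟩ := ι_ringInverse_mul_self (sub_ne_zero.2 hxy.symm)
  have e4 : g 1 0 * tr (g 1 1) = Ring.inverse (ι n (y - x)) := by
    rw [← mul_one (Ring.inverse _), ← e3, ← mul_assoc, i2, one_mul]
  have e5 : tr (g 1 1) * ord (g 1 1) = l • 1 := by
    have := congrArg ord hd'
    simpa [ord_ord] using this
  rw [← e4, mul_assoc, e5, mul_smul_comm, mul_one, smul_smul, inv_mul_cancel₀ hl, one_smul]

/-- The denominator `d` of such a matrix lies in the Clifford group of `ℝⁿ`. -/
theorem IsVahlen.exists_conj_tr {g : Mat n} (hg : IsVahlen g) {x y : E n}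
    (h0 : MapsTo g ((0 : E n) : OnePoint (E n)) x) (h1 : MapsTo g OnePoint.infty y) (v : E n) :
    ∃ w : E n, g 1 1 * ι n v * tr (g 1 1) = ι n w := by
  obtain ⟨hxy, ha, hb, l, hl, hd, hd', hc⟩ := hg.shape h0 h1
  obtain ⟨i1, i2⟩ := ι_ringInverse_mul_self (sub_ne_zero.2 hxy.symm)
  -- The image of the vector `(v, 0; 0, -v)` again has a vector and a scalar in its first column;
  -- eliminating `c` from these two entries isolates `d v dᵗ`.
  obtain ⟨w, s, m, hw⟩ := hg.preserves _ ⟨v, 0, 0, rfl⟩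
  rw [hg.twistedAd_eq] at hw
  have hxy' := sub_ne_zero.2 hxy.symm
  set C := g 1 0
  set D := g 1 1
  set G := ι n (y - x)
  have e1 : C * ι n v * ord (tr D) - D * ι n v * ord (tr C) = m • 1 := by
    have := congrFun (congrFun hw 1) 0
    simpa [lorVec, matOrd, matConj, Matrix.mul_apply, sub_eq_add_neg,
      Algebra.algebraMap_eq_smul_one] using this
  have e2 : ι n y * (C * ι n v * ord (tr D)) - ι n x * (D * ι n v * ord (tr C)) = ι n w := by
    have := congrFun (congrFun hw 0) 0
    simpa [lorVec, matOrd, matConj, Matrix.mul_apply, sub_eq_add_neg, ha, hb, mul_assoc] using this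
  have e3 : G * (D * ι n v * ord (tr C)) = ι n (w - m • y) := by
    have : C * ι n v * ord (tr D) = m • 1 + D * ι n v * ord (tr C) := by rw [← e1]; abel
    rw [this] at e2
    rw [map_sub, ← e2, map_smul, show G = ι n y - ι n x from map_sub _ _ _]
    simp only [mul_add, sub_mul, mul_smul_comm, mul_one]
    abel
  have e4 : ord (tr C) = -(l⁻¹ • (tr D * Ring.inverse G)) := by
    rw [hc, ← tr_ord, ord_smul, tr_smul, ord_mul, ord_ord, tr_mul, ord_ringInverse_ι hxy',
      tr_neg, tr_ringInverse_ι hxy', mul_neg, smul_neg]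
  rw [e4, mul_neg, mul_neg, mul_smul_comm, mul_smul_comm, ← mul_assoc, ← mul_assoc] at e3
  have e5 : D * ι n v * tr D = -l • (Ring.inverse G * ι n (w - m • y) * G) := by
    have k : Ring.inverse G * (G * (D * ι n v) * tr D * Ring.inverse G) * G =
        D * ι n v * tr D := by
      simp only [mul_assoc]
      rw [i2, mul_one, ← mul_assoc (Ring.inverse G) G, i2, one_mul]
    rw [← e3, mul_neg, neg_mul, mul_smul_comm, smul_mul_assoc, smul_neg, neg_smul, neg_neg, k,
      smul_smul, mul_inv_cancel₀ hl, one_smul]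
  refine ⟨(l * inner ℝ (y - x) (y - x) : ℝ) • invConj (y - x) (w - m • y), ?_⟩
  rw [e5, map_smul, ← ι_invConj hxy']
  -- A vector is a scalar multiple of its inverse, so conjugation by `G` is `invConj` up to scale.
  have e6 : ∀ a : Cl n, a * G = (-inner ℝ (y - x) (y - x) : ℝ) • (a * Ring.inverse G) := fun a => by
    have h3 : (inner ℝ (y - x) (y - x) : ℝ) ≠ 0 := by simpa using hxy'
    rw [ι_ringInverse hxy', mul_neg, smul_neg, neg_smul, neg_neg, mul_smul_comm, smul_smul,
      mul_inv_cancel₀ h3, one_smul]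
  rw [e6, smul_smul, neg_mul_neg]

/-- The transpose of the denominator lies in the Clifford group of `ℝⁿ` as well. -/
theorem IsVahlen.exists_tr_conj {g : Mat n} (hg : IsVahlen g) {x y : E n}
    (h0 : MapsTo g ((0 : E n) : OnePoint (E n)) x) (h1 : MapsTo g OnePoint.infty y) (v : E n) :
    ∃ w : E n, tr (g 1 1) * ι n v * g 1 1 = ι n w := by
  obtain ⟨-, -, -, l, hl, hd, hd', -⟩ := hg.shape h0 h1
  choose L hL using hg.exists_conj_tr h0 h1
  have ht : tr (g 1 1) * ord (g 1 1) = l • 1 := by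
    simpa [ord_ord] using congrArg ord hd'
  -- The map `v ↦ d v dᵗ` is undone by `w ↦ dᵗ w d` up to the factor `l²`. It is therefore
  -- injective, hence surjective by dimension, so every vector has the form on which `w ↦ dᵗ w d` is
  -- already known.
  let T : E n →ₗ[ℝ] E n :=
    { toFun := L
      map_add' := fun a b => ι_injective n (by rw [map_add, ← hL, ← hL, ← hL, map_add]; noncomm_ring)
      map_smul' := fun r a => ι_injective n (by
        rw [map_smul, ← hL, ← hL, map_smul, mul_smul_comm, smul_mul_assoc]; rfl) }
  have hsq : ∀ a, tr (g 1 1) * ι n (L a) * g 1 1 = (l * l) • ι n a := fun a => by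
    have e := congrArg ord (hL a)
    rw [ord_ι, ord_mul, ord_mul, ord_ι, mul_neg, neg_mul, neg_inj] at e
    rw [← e, mul_assoc, mul_assoc, mul_assoc, hd', ← mul_assoc, ht]
    simp [smul_smul]
  have hinj : Function.Injective T := by
    intro a b hab
    have e1 := hsq a
    rw [show L a = L b from hab, hsq b, ← map_smul, ← map_smul] at e1
    exact (smul_right_injective _ (mul_ne_zero hl hl) (ι_injective n e1)).symm
  obtain ⟨a, rfl⟩ := LinearMap.surjective_of_injective hinj v
  exact ⟨(l * l) • a, by rw [map_smul]; exact hsq a⟩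

/-- The similarity `v ↦ dᵗ v d` and its ratio. -/
theorem IsVahlen.exists_similarity {g : Mat n} (hg : IsVahlen g) {x y : E n}
    (h0 : MapsTo g ((0 : E n) : OnePoint (E n)) x) (h1 : MapsTo g OnePoint.infty y) :
    ∃ (l : ℝ) (L : E n → E n), l ≠ 0 ∧ (∀ v, tr (g 1 1) * ι n v * g 1 1 = ι n (L v)) ∧
      (∀ v, tr (g 1 0) * ι n v * g 1 0 = ι n ((l⁻¹ ^ 2) • L (invConj (y - x) v))) ∧
      (∀ v w, (inner ℝ (L v) (L w) : ℝ) = l ^ 2 * inner ℝ v w) ∧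
      (∀ v w, ι n (L v) * ι n (L w) = l • (tr (g 1 1) * (ι n v * ι n w) * ord (g 1 1))) ∧
      IsUnit (tr (g 1 1)) ∧ IsUnit (ord (g 1 1)) := by
  obtain ⟨hxy, -, -, l, hl, hd, hd', hc⟩ := hg.shape h0 h1
  choose L hL using hg.exists_tr_conj h0 h1
  have hxy' := sub_ne_zero.2 hxy.symm
  have ht : tr (g 1 1) * ord (g 1 1) = l • 1 := by
    simpa [ord_ord] using congrArg ord hd'
  have ht' : ord (g 1 1) * tr (g 1 1) = l • 1 := by
    simpa [ord_ord] using congrArg ord hd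
  -- The order involution changes the sign of both sides, giving a second formula for `L v`. Using
  -- one formula for each factor of `L v · L w`, the inner factors meet as `d d̃ᵗ = l`.
  have hL' : ∀ v, ord (tr (g 1 1)) * ι n v * ord (g 1 1) = ι n (L v) := fun v => by
    have e := congrArg ord (hL v)
    rwa [ord_ι, ord_mul, ord_mul, ord_ι, mul_neg, neg_mul, neg_inj] at e
  have hmul : ∀ v w, ι n (L v) * ι n (L w) =
      l • (tr (g 1 1) * (ι n v * ι n w) * ord (g 1 1)) := fun v w => by
    rw [← hL v, ← hL' w, mul_assoc, mul_assoc, mul_assoc, ← mul_assoc (g 1 1), hd]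
    simp [mul_assoc]
  have hunit : ∀ a b : Cl n, a * b = l • 1 → IsUnit a := fun a b hab => by
    have e1 : a * (l⁻¹ • b) = 1 := by
      rw [mul_smul_comm, hab, smul_smul, inv_mul_cancel₀ hl, one_smul]
    exact ⟨⟨a, l⁻¹ • b, e1, mul_eq_one_comm.1 e1⟩, rfl⟩
  refine ⟨l, L, hl, hL, fun v => ?_, fun v w => ?_, hmul, hunit _ _ ht, hunit _ _ ht'⟩
  · rw [hc, tr_smul, tr_mul, tr_ord, tr_ringInverse_ι hxy', map_smul, ← hL', ← ι_invConj hxy']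
    simp only [smul_mul_assoc, mul_smul_comm, smul_smul, mul_assoc, sq]

  · have e := ι_mul_add_mul n (L v) (L w)
    rw [hmul, hmul, ← smul_add, ← add_mul, ← mul_add, ι_mul_add_mul,
      Algebra.algebraMap_eq_smul_one, Algebra.algebraMap_eq_smul_one, mul_smul_comm,
      smul_mul_assoc, mul_one, ht, smul_smul, smul_smul] at e
    have := smul_one_injective e
    linarith

end Vahlen

/-! ### The differential and the Maurer–Cartan form -/

section Differential

variable {T : Type*} [NormedAddCommGroup T] [NormedSpace ℝ T]
  {M : Type*} [TopologicalSpace M] [ChartedSpace T M]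
  {V : Type*} [NormedAddCommGroup V] [NormedSpace ℝ V]
  {W : Type*} [NormedAddCommGroup W] [NormedSpace ℝ W]
  {U : Type*} [NormedAddCommGroup U] [NormedSpace ℝ U]

/-- The target is a vector space and the model has no boundary, so this is the definition; it
reduces calculus on `M` to Fréchet derivatives in the preferred chart. -/
theorem hasMFDerivAt_iff_comp_chart_symm {f : M → V} {p : M} {f' : T →L[ℝ] V} :
    HasMFDerivAt 𝓘(ℝ, T) 𝓘(ℝ, V) f p f' ↔ ContinuousAt f p ∧
      HasFDerivAt (f ∘ (chartAt T p).symm) f' (chartAt T p p) := by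
  change ContinuousAt f p ∧ HasFDerivWithinAt (f ∘ (chartAt T p).symm) f' (Set.range 𝓘(ℝ, T))
    (chartAt T p p) ↔ _
  rw [ModelWithCorners.range_eq_univ, hasFDerivWithinAt_univ]

theorem differentiableAt_comp_chart_symm {f : M → V} {p : M}
    (hf : MDifferentiableAt 𝓘(ℝ, T) 𝓘(ℝ, V) f p) :
    DifferentiableAt ℝ (f ∘ (chartAt T p).symm) (chartAt T p p) :=
  (hasMFDerivAt_iff_comp_chart_symm.1 hf.hasMFDerivAt).2.differentiableAt

theorem d_apply_eq_fderiv {f : M → V} {p : M} (hf : MDifferentiableAt 𝓘(ℝ, T) 𝓘(ℝ, V) f p)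
    (X : TangentSpace 𝓘(ℝ, T) p) :
    d T f p X = fderiv ℝ (f ∘ (chartAt T p).symm) (chartAt T p p) X := by
  rw [(hasMFDerivAt_iff_comp_chart_symm.1 hf.hasMFDerivAt).2.fderiv]
  rfl

theorem mdifferentiableAt_of_comp_chart_symm {f : M → V} {p : M} (hc : ContinuousAt f p)
    (h : DifferentiableAt ℝ (f ∘ (chartAt T p).symm) (chartAt T p p)) :
    MDifferentiableAt 𝓘(ℝ, T) 𝓘(ℝ, V) f p :=
  (hasMFDerivAt_iff_comp_chart_symm.2 ⟨hc, h.hasFDerivAt⟩).mdifferentiableAt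

theorem d_bilinear (B : V →L[ℝ] W →L[ℝ] U) {f : M → V} {g : M → W} {p : M}
    (hf : MDifferentiableAt 𝓘(ℝ, T) 𝓘(ℝ, V) f p) (hg : MDifferentiableAt 𝓘(ℝ, T) 𝓘(ℝ, W) g p)
    (X : TangentSpace 𝓘(ℝ, T) p) :
    d T (fun q => B (f q) (g q)) p X = B (d T f p X) (g p) + B (f p) (d T g p X) := by
  have h := differentiableAt_comp_chart_symm hf
  have h' := differentiableAt_comp_chart_symm hg
  have h2 : MDifferentiableAt 𝓘(ℝ, T) 𝓘(ℝ, U) (fun q => B (f q) (g q)) p := by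
    refine mdifferentiableAt_of_comp_chart_symm ?_
      ((B.isBoundedBilinearMap.differentiableAt _).comp _ (h.prodMk h'))
    exact B.isBoundedBilinearMap.continuous.continuousAt.comp
      (hf.continuousAt.prodMk hg.continuousAt)
  rw [d_apply_eq_fderiv h2, d_apply_eq_fderiv hf, d_apply_eq_fderiv hg]
  have := B.fderiv_of_bilinear h h'
  refine (DFunLike.congr_fun this X).trans ?_
  rw [add_comm]
  simp only [Function.comp_apply, OpenPartialHomeomorph.left_inv _ (mem_chart_source T p)]
  rfl

/-- Multiplication of the Clifford algebra as a continuous bilinear map. -/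
noncomputable def clMul (n : ℕ) : Cl n →L[ℝ] Cl n →L[ℝ] Cl n :=
  (LinearMap.mul ℝ (Cl n)).toContinuousBilinearMap

/-- The inclusion of the vectors as a continuous linear map. -/
noncomputable def ιL (n : ℕ) : E n →L[ℝ] Cl n := (ι n).toContinuousLinearMap

theorem d_ι_mul {n : ℕ} {f : M → E n} {g : M → Cl n} {p : M}
    (hf : MDifferentiableAt 𝓘(ℝ, T) 𝓘(ℝ, E n) f p)
    (hg : MDifferentiableAt 𝓘(ℝ, T) 𝓘(ℝ, Cl n) g p) (X : TangentSpace 𝓘(ℝ, T) p) :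
    d T (fun q => ι n (f q) * g q) p X = ι n (d T f p X) * g p + ι n (f p) * d T g p X :=
  d_bilinear ((clMul n).comp (ιL n)) hf hg X

end Differential

/-! ### The Maurer–Cartan form of a frame -/

section Frames

variable {T : Type*} [NormedAddCommGroup T] [NormedSpace ℝ T]
  {M : Type*} [TopologicalSpace M] [ChartedSpace T M] {n : ℕ} {F : M → Mat n} {f f' : M → E n}

theorem Smooth.mdifferentiableAt' {V : Type*} [NormedAddCommGroup V] [NormedSpace ℝ V] {f : M → V}
    (hf : Smooth T f) (p : M) : MDifferentiableAt 𝓘(ℝ, T) 𝓘(ℝ, V) f p :=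
  (hf p).mdifferentiableAt (by simp)

/-- The entry is `dᵗ db - bᵗ dd`. Since `b = f d` and `bᵗ = dᵗ f`, the terms in the derivative of
`d` cancel. The lower left entry is treated in the same way with `a = f' c`. -/
theorem IsFrame.maurerCartan_zero_one (hF : IsFrame T F f f') (hf : Smooth T f)
    (p : M) (X : TangentSpace 𝓘(ℝ, T) p) :
    maurerCartan T F p X 0 1 = tr (F p 1 1) * ι n (d T f p X) * F p 1 1 := by
  have hs := fun q => (hF.vahlen q).shape (hF.zero q) (hF.infty q)
  have hb : (fun q => F q 0 1) = fun q => ι n (f q) * F q 1 1 := funext fun q => (hs q).2.2.1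
  have h1 := d_ι_mul (hf.mdifferentiableAt' p) ((hF.smooth 1 1).mdifferentiableAt' p) X
  rw [← hb] at h1
  simp [maurerCartan, (hF.vahlen p).ringInverse, matConj, Matrix.mul_apply, h1, (hs p).2.2.1,
    mul_add, mul_assoc]

theorem IsFrame.maurerCartan_one_zero (hF : IsFrame T F f f') (hf' : Smooth T f')
    (p : M) (X : TangentSpace 𝓘(ℝ, T) p) :
    maurerCartan T F p X 1 0 = -(tr (F p 1 0) * ι n (d T f' p X) * F p 1 0) := by
  have hs := fun q => (hF.vahlen q).shape (hF.zero q) (hF.infty q)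
  have hb : (fun q => F q 0 0) = fun q => ι n (f' q) * F q 1 0 := funext fun q => (hs q).2.1
  have h1 := d_ι_mul (hf'.mdifferentiableAt' p) ((hF.smooth 1 0).mdifferentiableAt' p) X
  rw [← hb] at h1
  simp [maurerCartan, (hF.vahlen p).ringInverse, matConj, Matrix.mul_apply, h1, (hs p).2.1,
    mul_add, mul_assoc]

/-- The off-diagonal part of the Maurer–Cartan form of a frame: up to a similarity at each point
it is given by `df` and `g⁻¹ df' g⁻¹`. -/
theorem IsFrame.exists_similarity (hF : IsFrame T F f f') (hf : Smooth T f) (hf' : Smooth T f')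
    (p : M) : ∃ (l : ℝ) (L : E n → E n) (a b : Cl n), l ≠ 0 ∧ IsUnit a ∧ IsUnit b ∧
      (∀ X, maurerCartan T F p X 0 1 = ι n (L (d T f p X))) ∧
      (∀ X, maurerCartan T F p X 1 0 =
        ι n (-(l⁻¹ ^ 2) • L (invConj (f' p - f p) (d T f' p X)))) ∧
      (∀ v w, (inner ℝ (L v) (L w) : ℝ) = l ^ 2 * inner ℝ v w) ∧
      (∀ v w, ι n (L v) * ι n (L w) = l • (a * (ι n v * ι n w) * b)) := by
  obtain ⟨l, L, hl, h1, h2, h3, h4, ha, hb⟩ :=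
    (hF.vahlen p).exists_similarity (hF.zero p) (hF.infty p)
  refine ⟨l, L, _, _, hl, ha, hb, fun X => ?_, fun X => ?_, h3, h4⟩
  · rw [hF.maurerCartan_zero_one hf, h1]
  · rw [hF.maurerCartan_one_zero hf', h2, neg_smul, map_neg]

theorem IsFrame.ne (hF : IsFrame T F f f') (p : M) : f p ≠ f' p :=
  ((hF.vahlen p).shape (hF.zero p) (hF.infty p)).1

theorem IsFrame.mem_range (hF : IsFrame T F f f') (hf : Smooth T f) (hf' : Smooth T f') (p : M)
    (X : TangentSpace 𝓘(ℝ, T) p) : maurerCartan T F p X 0 1 ∈ Set.range (ι n) ∧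
        maurerCartan T F p X 1 0 ∈ Set.range (ι n) := by
  obtain ⟨l, L, a, b, -, -, -, h1, h2, -⟩ := hF.exists_similarity hf hf' p
  exact ⟨⟨_, (h1 X).symm⟩, ⟨_, (h2 X).symm⟩⟩

/-- At each point the two wedge products differ by a nonzero real factor and by units multiplied on
the left and right. The condition `f ≠ f'` comes with the frame. -/
theorem IsFrame.isDarbouxPair_iff (hF : IsFrame T F f f') (hf : Smooth T f) (hf' : Smooth T f')
    (hc : NonConst f) (hc' : NonConst f') :
    IsDarbouxPair T f f' ↔ WedgeZero (T := T) (fun p X => maurerCartan T F p X 0 1)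
      (fun p X => maurerCartan T F p X 1 0) := by
  have key : ∀ (p : M) (X Y : TangentSpace 𝓘(ℝ, T) p),
      maurerCartan T F p X 0 1 * maurerCartan T F p Y 1 0 -
        maurerCartan T F p Y 0 1 * maurerCartan T F p X 1 0 = 0 ↔
      ι n (d T f p X) * (Ring.inverse (ι n (f' p - f p)) * ι n (d T f' p Y) *
        Ring.inverse (ι n (f' p - f p))) -
      ι n (d T f p Y) * (Ring.inverse (ι n (f' p - f p)) * ι n (d T f' p X) *
        Ring.inverse (ι n (f' p - f p))) = 0 := by
    intro p X Y
    obtain ⟨l, L, a, b, hl, ha, hb, h1, h2, -, h4⟩ := hF.exists_similarity hf hf' p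
    have hg := sub_ne_zero.2 (hF.ne p).symm
    simp only [h1, h2, map_smul, mul_smul_comm, h4, ι_invConj hg]
    rw [← smul_sub, ← smul_sub, ← sub_mul, ← mul_sub, smul_eq_zero, smul_eq_zero,
      hb.mul_left_eq_zero, ha.mul_right_eq_zero]
    simp [hl]
  constructor
  · exact fun h p X Y => (key p X Y).2 (h.wedge p X Y)
  · exact fun h => ⟨hf, hf', hc, hc', hF.ne, fun p X Y => (key p X Y).1 (h p X Y)⟩

end Frames

/-! ### Pointwise theory on a Riemann surface -/

section Pointwise

variable {n : ℕ}

/-- The `(2,0)`-part of the symmetric product of two covectors `α`, `β` with values `A = α(1)`,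
`B = α(i)`, `P = β(1)`, `R = β(i)`. -/
noncomputable def qcoeff (A B P R : E n) : ℂ :=
  (((inner ℝ A P - inner ℝ B R) / 4 : ℝ) : ℂ) - (((inner ℝ A R + inner ℝ B P) / 4 : ℝ) : ℂ) *
    Complex.I

theorem qcoeff_ext_iff {A B P R : E n} {z : ℂ} : qcoeff A B P R = z ↔
    (inner ℝ A P - inner ℝ B R) / 4 = z.re ∧ -((inner ℝ A R + inner ℝ B P) / 4) = z.im := by
  rw [Complex.ext_iff]
  simp only [qcoeff, Complex.sub_re, Complex.sub_im, Complex.ofReal_re, Complex.ofReal_im,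
    Complex.re_ofReal_mul, Complex.im_ofReal_mul, Complex.I_re, Complex.I_im]
  simp

theorem qcoeff_smul_right (A B P R : E n) (r : ℝ) :
    qcoeff A B (r • P) (r • R) = r * qcoeff A B P R := by
  simp only [qcoeff, inner_smul_right]
  push_cast
  ring

theorem conformal_iff {A B : E n} : qcoeff A B A B = 0 ↔
    (inner ℝ B B : ℝ) = inner ℝ A A ∧ inner ℝ A B = (0 : ℝ) := by
  rw [qcoeff_ext_iff, real_inner_comm A B]
  simp only [Complex.zero_re, Complex.zero_im]
  constructor <;> rintro ⟨h1, h2⟩ <;> constructor <;> linarith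

/-- The shape of `P` and `R` gives `(B, R) = -(A, P)` and `(B, P) = (A, R)`, so the coefficient
carries exactly the two numbers that determine `P` and `R`. -/
theorem qcoeff_of_wedge {A B P R : E n} (hA : A ≠ 0) (hc : qcoeff A B A B = 0)
    (h : ι n A * ι n R - ι n B * ι n P = 0) :
    qcoeff A B P R = ((inner ℝ A P / 2 : ℝ) : ℂ) - ((inner ℝ A R / 2 : ℝ) : ℂ) * Complex.I := by
  obtain ⟨h1, h2⟩ := conformal_iff.1 hc
  obtain ⟨h3, h4⟩ := eq_of_wedge_eq_zero h2 h1 hA h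
  have hE0 : (inner ℝ A A : ℝ) ≠ 0 := by simpa using hA
  have h5 : inner ℝ B R = -(inner ℝ A P : ℝ) := by
    have := congrArg (inner ℝ B) h4
    rw [inner_sub_right, inner_smul_right, inner_smul_right, real_inner_comm A B, h2, h1] at this
    rw [this]
    field_simp; ring
  have h6 : inner ℝ B P = (inner ℝ A R : ℝ) := by
    have := congrArg (inner ℝ B) h3
    rw [inner_add_right, inner_smul_right, inner_smul_right, real_inner_comm A B, h2, h1] at this
    rw [this]
    field_simp; ring
  rw [qcoeff, h5, h6]
  push_cast
  ring

/-- A covector with `α ∧ β = 0` is determined by `(α, β)²'⁰`. -/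
theorem eq_smul_of_qcoeff_eq {A B P R P' R' : E n} (hA : A ≠ 0) (hc : qcoeff A B A B = 0)
    (h : ι n A * ι n R - ι n B * ι n P = 0) (h' : ι n A * ι n R' - ι n B * ι n P' = 0) {r : ℝ}
    (hq : qcoeff A B P R = r * qcoeff A B P' R') : P = r • P' ∧ R = r • R' := by
  obtain ⟨h1, h2⟩ := conformal_iff.1 hc
  obtain ⟨h3, h4⟩ := eq_of_wedge_eq_zero h2 h1 hA h
  obtain ⟨h5, h6⟩ := eq_of_wedge_eq_zero h2 h1 hA h'
  rw [qcoeff_of_wedge hA hc h, qcoeff_of_wedge hA hc h', Complex.ext_iff] at hq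
  simp only [Complex.sub_re, Complex.sub_im, Complex.ofReal_re, Complex.ofReal_im,
    Complex.re_ofReal_mul, Complex.im_ofReal_mul, Complex.I_re, Complex.I_im] at hq
  have e1 : (inner ℝ A P : ℝ) = r * inner ℝ A P' := by linarith [hq.1]
  have e2 : (inner ℝ A R : ℝ) = r * inner ℝ A R' := by linarith [hq.2]
  rw [e1, e2] at h3 h4
  refine ⟨h3.trans ?_, h4.trans ?_⟩
  · conv_rhs => rw [h5]
    module
  · conv_rhs => rw [h6]
    module

theorem clm_mul_one {V : Type*} [NormedAddCommGroup V] [NormedSpace ℝ V] (α : ℂ →L[ℝ] V) (c : ℂ) :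
    α c = c.re • α 1 + c.im • α Complex.I := by
  rw [← map_smul, ← map_smul, ← map_add]
  congr 1
  apply Complex.ext <;> simp

theorem clm_mul_I {V : Type*} [NormedAddCommGroup V] [NormedSpace ℝ V] (α : ℂ →L[ℝ] V) (c : ℂ) :
    α (c * Complex.I) = c.re • α Complex.I - c.im • α 1 := by
  rw [← map_smul, ← map_smul, ← map_sub]
  congr 1
  apply Complex.ext <;> simp

/-- The transformation law of a quadratic differential under a change of holomorphic coordinate with
derivative `c`. -/
theorem qcoeff_comp_mul (α β : ℂ →L[ℝ] E n) (c : ℂ) :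
    qcoeff (α c) (α (c * Complex.I)) (β c) (β (c * Complex.I)) =
      qcoeff (α 1) (α Complex.I) (β 1) (β Complex.I) * c ^ 2 := by
  rw [clm_mul_one α, clm_mul_I α, clm_mul_one β, clm_mul_I β]
  rw [qcoeff_ext_iff]
  simp only [qcoeff, sq, Complex.mul_re, Complex.mul_im, Complex.sub_re, Complex.sub_im,
    Complex.ofReal_re, Complex.ofReal_im, Complex.I_re, Complex.I_im, inner_add_left,
    inner_sub_left, inner_add_right, inner_sub_right, inner_smul_left, inner_smul_right]
  simp only [conj_trivial]
  constructor <;> ring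

end Pointwise

/-! ### The form of a Darboux pair and the Riccati equation -/

section Surface

variable {M : Type*} [TopologicalSpace M] [ChartedSpace ℂ M] {n : ℕ}

/-- The differential at a point of a Riemann surface, in the preferred chart. -/
noncomputable abbrev dC {V : Type*} [NormedAddCommGroup V] [NormedSpace ℝ V] (f : M → V) (p : M) :
    ℂ →L[ℝ] V := d ℂ f p

/-- The vector-valued form `g⁻¹ df' g⁻¹` with `g = f' - f`, in the preferred chart. -/
noncomputable def pairForm (f f' : M → E n) (p : M) : ℂ →L[ℝ] E n :=
  (LinearMap.toContinuousLinearMap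
    { toFun := invConj (f' p - f p)
      map_add' := fun v w => by simp only [invConj, inner_add_right]; module
      map_smul' := fun r v => by
        simp only [invConj, inner_smul_right, RingHom.id_apply]; module }).comp (dC f' p)

theorem pairForm_apply (f f' : M → E n) (p : M) (X : ℂ) :
    pairForm f f' p X = invConj (f' p - f p) (dC f' p X) := rfl

theorem twoZero_eq_qcoeff (α β : (p : M) → TangentSpace 𝓘(ℝ, ℂ) p → E n) (p : M) :
    twoZero α β p = qcoeff (α p (1 : ℂ)) (α p Complex.I) (β p (1 : ℂ)) (β p Complex.I) := by
  simp only [twoZero, qcoeff]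
  push_cast
  ring

variable {Q : Polarisation M} {f f' fc : M → E n} {F : M → Mat n}

theorem IsConformalImmersion.qcoeff_eq_zero (hf : IsConformalImmersion f) (p : M) :
    qcoeff (dC f p 1) (dC f p Complex.I) (dC f p 1) (dC f p Complex.I) = 0 := by
  have h := hf.conformal p
  rw [twoZero_eq_qcoeff] at h
  exact h

theorem IsConformalImmersion.dC_ne_zero (hf : IsConformalImmersion f) (p : M) {c : ℂ}
    (hc : c ≠ 0) : dC f p c ≠ 0 := fun h =>
  hc (hf.immersion p (a₁ := c) (a₂ := (0 : ℂ)) (h.trans (map_zero (dC f p)).symm))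

theorem IsDarbouxPair.wedge_pairForm (h : IsDarbouxPair ℂ f f') (p : M) (X Y : ℂ) :
    ι n (dC f p X) * ι n (pairForm f f' p Y) - ι n (dC f p Y) * ι n (pairForm f f' p X) = 0 := by
  have hg := sub_ne_zero.2 (h.ne p).symm
  have := h.wedge p X Y
  simp only [ι_invConj hg] at this
  exact this

/-- The factor `l²` of the similarity cancels against the `l⁻²` in the lower left entry; only the
sign of that entry remains. -/
theorem IsFrame.twoZero_eq (hF : IsFrame ℂ F f f') (hf : Smooth ℂ f) (hf' : Smooth ℂ f') (p : M) :
    twoZero (fun q X => toVec n (maurerCartan ℂ F q X 0 1))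
      (fun q X => toVec n (maurerCartan ℂ F q X 1 0)) p =
    -qcoeff (dC f p 1) (dC f p Complex.I) (pairForm f f' p 1) (pairForm f f' p Complex.I) := by
  obtain ⟨l, L, a, b, hl, -, -, h1, h2, h3, -⟩ := hF.exists_similarity hf hf' p
  have e : ∀ v w, inner ℝ (L v) (-(l⁻¹ ^ 2) • L w) = -(inner ℝ v w : ℝ) := fun v w => by
    rw [inner_smul_right, h3]; field_simp
  rw [twoZero_eq_qcoeff]
  have h1' : ∀ X : ℂ, toVec n (maurerCartan ℂ F p X 0 1) = L (dC f p X) := fun X =>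
    (congrArg (toVec n) (h1 X)).trans (toVec_ι n _)
  have h2' : ∀ X : ℂ, toVec n (maurerCartan ℂ F p X 1 0) = -(l⁻¹ ^ 2) • L (pairForm f f' p X) :=
    fun X => (congrArg (toVec n) (h2 X)).trans (toVec_ι n _)
  rw [h1', h1', h2', h2']
  simp only [qcoeff, e]
  push_cast
  ring

theorem d_sub {T : Type*} [NormedAddCommGroup T] [NormedSpace ℝ T] {M : Type*} [TopologicalSpace M]
    [ChartedSpace T M] {V : Type*} [NormedAddCommGroup V] [NormedSpace ℝ V] {f g : M → V} {p : M}
    (hf : MDifferentiableAt 𝓘(ℝ, T) 𝓘(ℝ, V) f p) (hg : MDifferentiableAt 𝓘(ℝ, T) 𝓘(ℝ, V) g p)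
    (X : TangentSpace 𝓘(ℝ, T) p) : d T (fun q => f q - g q) p X = d T f p X - d T g p X := by
  have h := differentiableAt_comp_chart_symm hf
  have h' := differentiableAt_comp_chart_symm hg
  have h2 : MDifferentiableAt 𝓘(ℝ, T) 𝓘(ℝ, V) (fun q => f q - g q) p :=
    mdifferentiableAt_of_comp_chart_symm (hf.continuousAt.sub hg.continuousAt) (h.sub h')
  rw [d_apply_eq_fderiv h2, d_apply_eq_fderiv hf, d_apply_eq_fderiv hg]
  exact DFunLike.congr_fun (fderiv_sub h h') X

/-- The Riccati equation says that `g⁻¹ df' g⁻¹ = r dfc`. -/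
theorem riccati_iff {p : M} (hp : f p ≠ f' p) (hf : Smooth ℂ f) (hf' : Smooth ℂ f') (r : ℝ)
    (X : TangentSpace 𝓘(ℝ, ℂ) p) :
    (ι n (d ℂ (fun q => f' q - f q) p X) =
        r • (ι n (f' p - f p) * ι n (d ℂ fc p X) * ι n (f' p - f p)) - ι n (d ℂ f p X)) ↔
    pairForm f f' p X = r • dC fc p X := by
  have hg := sub_ne_zero.2 hp.symm
  obtain ⟨h1, h2⟩ := ι_ringInverse_mul_self hg
  rw [d_sub (hf'.mdifferentiableAt' p) (hf.mdifferentiableAt' p), map_sub, sub_left_inj,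
    ← (ι_injective n).eq_iff]
  change ι n (dC f' p X) = r • (ι n (f' p - f p) * ι n (dC fc p X) * ι n (f' p - f p)) ↔
    ι n (invConj (f' p - f p) (dC f' p X)) = ι n (r • dC fc p X)
  rw [← ι_invConj hg, map_smul]
  constructor
  · intro h
    rw [h, mul_smul_comm, smul_mul_assoc]
    congr 1
    rw [mul_assoc _ _ (ι n (f' p - f p)), ← mul_assoc, h2, one_mul, mul_assoc, h1, mul_one]
  · intro h
    rw [← smul_mul_assoc, ← mul_smul_comm, ← h, mul_assoc _ _ (Ring.inverse _), ← mul_assoc, h1,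
      one_mul, mul_assoc, h2, mul_one]

theorem dC_eq_zero_of_pairForm {p : M} (hp : f p ≠ f' p) (h : ∀ X, pairForm f f' p X = 0) :
    dC f' p = 0 :=
  ContinuousLinearMap.ext fun X => invConj_eq_zero (sub_ne_zero.2 hp.symm) (h X)

theorem clm_ext_one_I {V : Type*} [NormedAddCommGroup V] [NormedSpace ℝ V] {α β : ℂ →L[ℝ] V}
    (h1 : α 1 = β 1) (h2 : α Complex.I = β Complex.I) : α = β := by
  ext X
  rw [clm_mul_one α, clm_mul_one β, h1, h2]

theorem IsChristoffel.qcoeff_eq (h : IsChristoffel Q f fc) (p : M) :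
    qcoeff (dC f p 1) (dC f p Complex.I) (dC fc p 1) (dC fc p Complex.I) = Q.coeff p := by
  have h := h.twoZero p
  rw [twoZero_eq_qcoeff] at h
  exact h

/-- The Darboux pair equation as an equation of quadratic differentials. -/
theorem pairForm_eq_smul_iff (hf : IsConformalImmersion f) (h : IsDarbouxPair ℂ f f')
    (hc : IsChristoffel Q f fc) (r : ℝ) (p : M) : pairForm f f' p = r • dC fc p ↔
      qcoeff (dC f p 1) (dC f p Complex.I) (pairForm f f' p 1) (pairForm f f' p Complex.I) =
        r * Q.coeff p := by
  rw [← hc.qcoeff_eq p]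
  constructor
  · intro e
    rw [e]
    exact qcoeff_smul_right _ _ _ _ r
  · intro e
    obtain ⟨e1, e2⟩ := eq_smul_of_qcoeff_eq (hf.dC_ne_zero p one_ne_zero) (hf.qcoeff_eq_zero p)
      (h.wedge_pairForm p 1 Complex.I) (hc.wedge p (1 : ℂ) Complex.I) e
    exact clm_ext_one_I e1 e2

theorem isDarbouxTransform_iff (hf : IsConformalImmersion f) (h : IsDarbouxPair ℂ f f')
    (hc : IsChristoffel Q f fc) (hne : ∃ p, dC f' p ≠ 0) (r : ℝ) :
    IsDarbouxTransform Q r f f' ↔ ∀ p, qcoeff (dC f p 1) (dC f p Complex.I) (pairForm f f' p 1)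
      (pairForm f f' p Complex.I) = r * Q.coeff p := by
  constructor
  · rintro ⟨-, -, fd, hd, e⟩ p
    rw [← pairForm_eq_smul_iff hf h hd]
    exact ContinuousLinearMap.ext fun X => (riccati_iff (h.ne p) hf.smooth h.smooth' r X).1 (e p X)
  · intro e
    have e' := fun p => (pairForm_eq_smul_iff hf h hc r p).2 (e p)
    refine ⟨?_, h, fc, hc, fun p X => (riccati_iff (h.ne p) hf.smooth h.smooth' r X).2
      (DFunLike.congr_fun (e' p) X)⟩
    -- For `r = 0` the form `g⁻¹ df' g⁻¹` vanishes identically, and with it `df'`.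
    rintro rfl
    obtain ⟨p, hp⟩ := hne
    refine hp (dC_eq_zero_of_pairForm (h.ne p) fun X => ?_)
    rw [e' p, zero_smul]; rfl

end Surface

open Filter Topology

/-! ### Charts of a Riemann surface -/

section Charts

variable {M : Type*} [TopologicalSpace M] [ChartedSpace ℂ M]

theorem isManifold_real [h : IsManifold 𝓘(ℂ, ℂ) ω M] : IsManifold 𝓘(ℝ, ℂ) ∞ M := by
  refine isManifold_of_contDiffOn 𝓘(ℝ, ℂ) ∞ M fun e e' he he' => ?_
  have h1 := (contDiffGroupoid ω 𝓘(ℂ, ℂ)).compatible he he'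
  rw [contDiffGroupoid, mem_groupoid_of_pregroupoid] at h1
  have h2 : ContDiffOn ℂ ω (𝓘(ℂ, ℂ) ∘ (e.symm ≫ₕ e') ∘ 𝓘(ℂ, ℂ).symm)
    (𝓘(ℂ, ℂ).symm ⁻¹' (e.symm ≫ₕ e').source ∩ Set.range 𝓘(ℂ, ℂ)) := h1.1
  exact (h2.restrict_scalars ℝ).of_le le_top

theorem isManifold_one [h : IsManifold 𝓘(ℂ, ℂ) ω M] : IsManifold 𝓘(ℂ, ℂ) 1 M :=
  IsManifold.of_le (n := ω) le_top

/-- Unique continuation of a property from a neighbourhood of a point, along chart balls. -/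
theorem forall_of_eventually [PreconnectedSpace M] {P : M → Prop}
    (h : ∀ φ ∈ atlas ℂ M, ∀ (z₀ : ℂ) (r : ℝ), Metric.ball z₀ r ⊆ φ.target →
      ∀ z ∈ Metric.ball z₀ r, (∀ᶠ w in 𝓝 z, P (φ.symm w)) → ∀ w ∈ Metric.ball z₀ r, P (φ.symm w))
    {p₀ : M} (h0 : ∀ᶠ p in 𝓝 p₀, P p) (p : M) : P p := by
  have hopen : IsOpen {p : M | ∀ᶠ q in 𝓝 p, P q} := isOpen_setOfPred_eventually_nhds
  have hclosed : IsClosed {p : M | ∀ᶠ q in 𝓝 p, P q} := by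
    refine isClosed_of_closure_subset fun p hp => ?_
    set φ := chartAt ℂ p
    obtain ⟨r, hr, hball⟩ := Metric.isOpen_iff.1 φ.open_target (φ p) (mem_chart_target ℂ p)
    have hB : φ.source ∩ φ ⁻¹' Metric.ball (φ p) r ∈ 𝓝 p :=
      (φ.isOpen_inter_preimage Metric.isOpen_ball).mem_nhds
        ⟨mem_chart_source ℂ p, Metric.mem_ball_self hr⟩
    obtain ⟨q, ⟨hq, hqB⟩, hqP⟩ := mem_closure_iff_nhds.1 hp _ hB
    have h1 : ∀ᶠ w in 𝓝 (φ q), P (φ.symm w) := by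
      have : ContinuousAt φ.symm (φ q) := φ.continuousAt_symm (φ.map_source hq)
      refine this.eventually ?_
      rwa [φ.left_inv hq]
    have h2 := h φ (chart_mem_atlas ℂ p) _ r hball _ hqB h1
    filter_upwards [hB] with x hx
    rw [← φ.left_inv hx.1]
    exact h2 _ hx.2
  have := IsClopen.eq_univ ⟨hclosed, hopen⟩ ⟨p₀, h0⟩
  exact (this ▸ Set.mem_univ p : p ∈ {p : M | ∀ᶠ q in 𝓝 p, P q}).self_of_nhds
variable [IsManifold 𝓘(ℂ, ℂ) ω M] {V : Type*} [NormedAddCommGroup V] [NormedSpace ℝ V]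

theorem Smooth.contDiffOn_comp_symm {f : M → V} (hf : Smooth ℂ f) {φ : OpenPartialHomeomorph M ℂ}
    (hφ : φ ∈ atlas ℂ M) : ContDiffOn ℝ ∞ (f ∘ φ.symm) φ.target := by
  have : IsManifold 𝓘(ℝ, ℂ) ∞ M := isManifold_real
  rw [← contMDiffOn_iff_contDiffOn]
  exact hf.comp_contMDiffOn (contMDiffOn_symm_of_mem_maximalAtlas
    (IsManifold.subset_maximalAtlas hφ))

theorem coordField_ne_zero {φ : OpenPartialHomeomorph M ℂ} (hφ : φ ∈ atlas ℂ M) {z : ℂ}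
    (hz : z ∈ φ.target) : coordField φ z ≠ 0 := by
  have : IsManifold 𝓘(ℂ, ℂ) 1 M := isManifold_one
  have h := (mdifferentiable_of_mem_atlas (I := 𝓘(ℂ, ℂ)) hφ).symm
  have h1 := h.mfderiv_injective (x := z) hz
  intro h0
  refine one_ne_zero (α := ℂ) (h1 (?_ : _ = mfderiv 𝓘(ℂ, ℂ) 𝓘(ℂ, ℂ) φ.symm z (0 : ℂ)))
  exact Eq.trans h0 (map_zero (mfderiv 𝓘(ℂ, ℂ) 𝓘(ℂ, ℂ) φ.symm z)).symm

/-- By its definition `coordField φ z` is the derivative at `z` of the change from `φ` to the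
preferred chart at that point, and this derivative is complex linear. -/
theorem hasFDerivAt_transition {φ : OpenPartialHomeomorph M ℂ} (hφ : φ ∈ atlas ℂ M) {z : ℂ}
    (hz : z ∈ φ.target) : HasFDerivAt (chartAt ℂ (φ.symm z) ∘ φ.symm)
      ((ContinuousLinearMap.mul ℝ ℂ) (coordField φ z)) z := by
  have : IsManifold 𝓘(ℂ, ℂ) 1 M := isManifold_one
  have h : MDifferentiableAt 𝓘(ℂ, ℂ) 𝓘(ℂ, ℂ) φ.symm z := mdifferentiableAt_atlas_symm hφ hz
  obtain ⟨L, h1, hL⟩ : ∃ L : ℂ →L[ℂ] ℂ, HasFDerivWithinAt (chartAt ℂ (φ.symm z) ∘ φ.symm) L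
      (Set.range 𝓘(ℂ, ℂ)) z ∧ coordField φ z = L 1 := ⟨_, h.hasMFDerivAt.2, rfl⟩
  rw [ModelWithCorners.range_eq_univ, hasFDerivWithinAt_univ] at h1
  refine (h1.restrictScalars ℝ).congr_fderiv ?_
  ext X
  have e : L X = X • L 1 := by rw [← map_smul, smul_eq_mul, mul_one]
  simp [hL, e, mul_comm]

/-- Tangent vectors are read in a preferred chart that varies with the point. This chain rule passes
to one fixed chart, where second derivatives make sense. -/
theorem hasFDerivAt_comp_symm {f : M → V} {φ : OpenPartialHomeomorph M ℂ} (hφ : φ ∈ atlas ℂ M)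
    {z : ℂ} (hz : z ∈ φ.target)
    (hf : MDifferentiableAt 𝓘(ℝ, ℂ) 𝓘(ℝ, V) f (φ.symm z)) : HasFDerivAt (f ∘ φ.symm)
      ((dC f (φ.symm z)).comp ((ContinuousLinearMap.mul ℝ ℂ) (coordField φ z))) z := by
  set p := φ.symm z with hp
  have h1 : HasFDerivAt (f ∘ (chartAt ℂ p).symm) (dC f p) (chartAt ℂ p p) :=
    (hasMFDerivAt_iff_comp_chart_symm.1 hf.hasMFDerivAt).2
  have h2 := h1.comp z (hasFDerivAt_transition hφ hz)
  refine h2.congr_of_eventuallyEq ?_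
  have h3 : ∀ᶠ w in 𝓝 z, φ.symm w ∈ (chartAt ℂ p).source :=
    (φ.continuousAt_symm hz).eventually
      ((chartAt ℂ p).open_source.mem_nhds (mem_chart_source ℂ p))
  filter_upwards [h3] with w hw
  exact (congrArg f ((chartAt ℂ p).left_inv hw)).symm

theorem fderiv_comp_symm {f : M → V} (hf : Smooth ℂ f) {φ : OpenPartialHomeomorph M ℂ}
    (hφ : φ ∈ atlas ℂ M) {z : ℂ} (hz : z ∈ φ.target) (X : ℂ) :
    fderiv ℝ (f ∘ φ.symm) z X = dC f (φ.symm z) (coordField φ z * X) := by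
  rw [(hasFDerivAt_comp_symm hφ hz (hf.mdifferentiableAt' _)).fderiv]
  rfl

theorem const_of_dC_eq_zero [PreconnectedSpace M] {f : M → V} (hf : Smooth ℂ f)
    (h : ∀ p, dC f p = 0) (p q : M) : f p = f q := by
  have hloc : ∀ φ ∈ atlas ℂ M, ∀ (z₀ : ℂ) (r : ℝ), Metric.ball z₀ r ⊆ φ.target →
      ∀ z ∈ Metric.ball z₀ r, ∀ w ∈ Metric.ball z₀ r, f (φ.symm w) = f (φ.symm z) := by
    intro φ hφ z₀ r hB z hz w hw
    refine Metric.isOpen_ball.is_const_of_fderiv_eq_zero (𝕜 := ℝ) (f := f ∘ φ.symm)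
      (convex_ball _ _).isPreconnected
      (((hf.contDiffOn_comp_symm hφ).differentiableOn (by simp)).mono hB) ?_ hw hz
    intro y hy
    ext X
    rw [fderiv_comp_symm hf hφ (hB hy), h]
    rfl
  refine forall_of_eventually (P := fun p => f p = f q) ?_ (p₀ := q) ?_ p
  · intro φ hφ z₀ r hB z hz h1 w hw
    rw [hloc φ hφ z₀ r hB z hz w hw]
    exact h1.self_of_nhds
  · set φ := chartAt ℂ q
    obtain ⟨r, hr, hball⟩ := Metric.isOpen_iff.1 φ.open_target (φ q) (mem_chart_target ℂ q)
    have hB : φ.source ∩ φ ⁻¹' Metric.ball (φ q) r ∈ 𝓝 q :=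
      (φ.isOpen_inter_preimage Metric.isOpen_ball).mem_nhds
        ⟨mem_chart_source ℂ q, Metric.mem_ball_self hr⟩
    filter_upwards [hB] with x hx
    have := hloc φ (chart_mem_atlas ℂ q) _ r hball _ (Metric.mem_ball_self hr) _ hx.2
    rwa [φ.left_inv hx.1, φ.left_inv (mem_chart_source ℂ q)] at this

/-- The identity theorem for holomorphic quadratic differentials. -/
theorem quadDiff_eq_zero [PreconnectedSpace M] {h : M → ℂ} (hh : ∀ φ ∈ atlas ℂ M,
    DifferentiableOn ℂ (fun z => h (φ.symm z) * coordField φ z ^ 2) φ.target) {p₀ : M}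
    (h0 : ∀ᶠ p in 𝓝 p₀, h p = 0) (p : M) : h p = 0 := by
  refine forall_of_eventually (P := fun p => h p = 0) ?_ h0 p
  intro φ hφ z₀ r hB z hz h1 w hw
  have h2 := (((hh φ hφ).mono hB).analyticOnNhd Metric.isOpen_ball).eqOn_zero_of_preconnected_of_eventuallyEq_zero
    (convex_ball _ _).isPreconnected hz (h1.mono fun y hy => by simp [hy]) hw
  exact (mul_eq_zero.1 h2).resolve_right (pow_ne_zero _ (coordField_ne_zero hφ (hB hw)))

end Charts

/-! ### Partial derivatives on plane domains -/

section PartialDerivatives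

variable {V : Type*} [NormedAddCommGroup V] [NormedSpace ℝ V]
  {W : Type*} [NormedAddCommGroup W] [InnerProductSpace ℝ W]
  {U : Set ℂ} {f g : ℂ → V} {z : ℂ}

/-- The directional derivative of a function of a complex variable. -/
noncomputable def pd (e : ℂ) (f : ℂ → V) (z : ℂ) : V := fderiv ℝ f z e

theorem pd_congr (hU : IsOpen U) (h : Set.EqOn f g U) (hz : z ∈ U) (e : ℂ) :
    pd e f z = pd e g z := by
  rw [pd, pd, (h.eventuallyEq_of_mem (hU.mem_nhds hz)).fderiv_eq]

theorem ContDiffOn.diffAt (hf : ContDiffOn ℝ ∞ f U) (hU : IsOpen U) (hz : z ∈ U) :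
    DifferentiableAt ℝ f z :=
  (hf.contDiffAt (hU.mem_nhds hz)).differentiableAt (by simp)

theorem ContDiffOn.pd (hf : ContDiffOn ℝ ∞ f U) (hU : IsOpen U) (e : ℂ) :
    ContDiffOn ℝ ∞ (pd e f) U :=
  (hf.fderiv_of_isOpen hU (m := ∞) (by simp)).clm_apply contDiffOn_const

theorem pd_comm (hf : ContDiffOn ℝ ∞ f U) (hU : IsOpen U) (hz : z ∈ U) (e e' : ℂ) :
    pd e (pd e' f) z = pd e' (pd e f) z := by
  have h1 : DifferentiableAt ℝ (fderiv ℝ f) z :=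
    ContDiffOn.diffAt (hf.fderiv_of_isOpen hU (m := ∞) (by simp)) hU hz
  have key : ∀ a b, pd a (pd b f) z = fderiv ℝ (fderiv ℝ f) z a b := fun a b => by
    change fderiv ℝ (fun w => fderiv ℝ f w b) z a = _
    rw [fderiv_clm_apply h1 (differentiableAt_const _)]
    simp
  rw [key, key]
  exact ((hf.contDiffAt (hU.mem_nhds hz)).isSymmSndFDerivAt (by
    simp only [minSmoothness_of_isRCLikeNormedField]; exact WithTop.coe_le_coe.2 le_top)) e e'

theorem pd_const (e : ℂ) (v : V) (z : ℂ) : pd e (fun _ => v) z = 0 := by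
  simp [pd]

theorem pd_add (hf : DifferentiableAt ℝ f z) (hg : DifferentiableAt ℝ g z) (e : ℂ) :
    pd e (fun w => f w + g w) z = pd e f z + pd e g z := by
  simp [pd, fderiv_fun_add hf hg]

theorem pd_sub (hf : DifferentiableAt ℝ f z) (hg : DifferentiableAt ℝ g z) (e : ℂ) :
    pd e (fun w => f w - g w) z = pd e f z - pd e g z := by
  simp [pd, fderiv_fun_sub hf hg]

theorem pd_smul {c : ℂ → ℝ} (hc : DifferentiableAt ℝ c z) (hf : DifferentiableAt ℝ f z) (e : ℂ) :
    pd e (fun w => c w • f w) z = pd e c z • f z + c z • pd e f z := by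
  simp [pd, fderiv_fun_smul hc hf, add_comm]

theorem pd_const_smul (r : ℝ) (hf : DifferentiableAt ℝ f z) (e : ℂ) :
    pd e (fun w => r • f w) z = r • pd e f z := by
  simp [pd, fderiv_fun_const_smul hf]

theorem pd_mul {a b : ℂ → ℝ} (ha : DifferentiableAt ℝ a z) (hb : DifferentiableAt ℝ b z) (e : ℂ) :
    pd e (fun w => a w * b w) z = pd e a z * b z + a z * pd e b z :=
  pd_smul ha hb e

theorem pd_inner {a b : ℂ → W} (ha : DifferentiableAt ℝ a z) (hb : DifferentiableAt ℝ b z)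
    (e : ℂ) : pd e (fun w => inner ℝ (a w) (b w)) z =
      inner ℝ (pd e a z) (b z) + inner ℝ (a z) (pd e b z) := by
  simp [pd, fderiv_inner_apply ℝ ha hb, add_comm]

theorem pd_inner_const (v : W) {b : ℂ → W} (hb : DifferentiableAt ℝ b z)
    (e : ℂ) : pd e (fun w => inner ℝ v (b w)) z = inner ℝ v (pd e b z) := by
  rw [pd_inner (differentiableAt_const v) hb, pd_const, inner_zero_left, zero_add]

theorem pd_inv {a : ℂ → ℝ} (ha : DifferentiableAt ℝ a z) (h0 : a z ≠ 0) (e : ℂ) :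
    pd e (fun w => (a w)⁻¹) z = -((a z)⁻¹ ^ 2 * pd e a z) := by
  have h : HasFDerivAt (fun w => (a w)⁻¹) _ z :=
    (hasDerivAt_inv h0).comp_hasFDerivAt z ha.hasFDerivAt
  rw [pd, h.fderiv, pd]
  simp

theorem pd_exp {a : ℂ → ℝ} (ha : DifferentiableAt ℝ a z) (e : ℂ) :
    pd e (fun w => Real.exp (a w)) z = Real.exp (a z) * pd e a z := by
  rw [pd, (ha.hasFDerivAt.exp).fderiv, pd]
  simp

theorem eq_zero_of_pd_eq_zero (h1 : pd 1 f z = 0) (h2 : pd Complex.I f z = 0) :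
    fderiv ℝ f z = 0 :=
  clm_ext_one_I h1 h2

theorem const_of_pd_eq_zero (hU : IsOpen U) (hc : IsPreconnected U) (hf : ContDiffOn ℝ ∞ f U)
    (h1 : ∀ z ∈ U, pd 1 f z = 0) (h2 : ∀ z ∈ U, pd Complex.I f z = 0) {z w : ℂ} (hz : z ∈ U)
    (hw : w ∈ U) : f z = f w :=
  hU.is_const_of_fderiv_eq_zero (𝕜 := ℝ) hc (hf.differentiableOn (by simp))
    (fun x hx => eq_zero_of_pd_eq_zero (h1 x hx) (h2 x hx)) hz hw

end PartialDerivatives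

/-! ### Conformal immersions of plane domains -/

section PlaneConformal

/-- The imaginary part is `-b`, which explains the signs in the two equations. -/
theorem differentiableAt_of_cauchyRiemann {a b : ℂ → ℝ} {z : ℂ} (ha : DifferentiableAt ℝ a z)
    (hb : DifferentiableAt ℝ b z) (h1 : pd Complex.I a z = pd 1 b z)
    (h2 : pd Complex.I b z = -pd 1 a z) :
    DifferentiableAt ℂ (fun w => ((a w : ℝ) : ℂ) - ((b w : ℝ) : ℂ) * Complex.I) z := by
  have hF : HasFDerivAt (fun w => ((a w : ℝ) : ℂ) - ((b w : ℝ) : ℂ) * Complex.I) _ z :=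
    (Complex.ofRealCLM.hasFDerivAt.comp z ha.hasFDerivAt).sub
      ((Complex.ofRealCLM.hasFDerivAt.comp z hb.hasFDerivAt).mul_const Complex.I)
  rw [differentiableAt_complex_iff_differentiableAt_real]
  refine ⟨hF.differentiableAt, ?_⟩
  rw [hF.fderiv]
  simp only [pd] at h1 h2
  simp [h1, h2, mul_comm Complex.I, sub_mul, mul_assoc]
  ring

variable {n : ℕ} {U : Set ℂ} {f : ℂ → E n} {z : ℂ}

/-- Conformal immersions of an open set of the plane. -/
structure ConformalOn (U : Set ℂ) (f : ℂ → E n) : Prop where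
  isOpen : IsOpen U
  smooth : ContDiffOn ℝ ∞ f U
  ne_zero : ∀ z ∈ U, pd 1 f z ≠ 0
  norm_eq : ∀ z ∈ U, (inner ℝ (pd Complex.I f z) (pd Complex.I f z) : ℝ) =
    inner ℝ (pd 1 f z) (pd 1 f z)
  inner_eq : ∀ z ∈ U, inner ℝ (pd 1 f z) (pd Complex.I f z) = (0 : ℝ)

/-- The conformal factor. -/
noncomputable def cfac (f : ℂ → E n) (z : ℂ) : ℝ := inner ℝ (pd 1 f z) (pd 1 f z)

variable (hf : ConformalOn U f)
include hf

theorem ConformalOn.diffAt (hz : z ∈ U) : DifferentiableAt ℝ f z :=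
  ContDiffOn.diffAt hf.smooth hf.isOpen hz

theorem ConformalOn.diffAt_pd (hz : z ∈ U) (e : ℂ) : DifferentiableAt ℝ (pd e f) z :=
  ContDiffOn.diffAt (ContDiffOn.pd hf.smooth hf.isOpen e) hf.isOpen hz

theorem ConformalOn.cfac_pos (hz : z ∈ U) : 0 < cfac f z :=
  real_inner_self_pos.2 (hf.ne_zero z hz)

theorem ConformalOn.smooth_cfac : ContDiffOn ℝ ∞ (cfac f) U :=
  (ContDiffOn.pd hf.smooth hf.isOpen 1).inner ℝ (ContDiffOn.pd hf.smooth hf.isOpen 1)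

theorem ConformalOn.pd_cfac (hz : z ∈ U) (e : ℂ) :
    pd e (cfac f) z = 2 * inner ℝ (pd e (pd 1 f) z) (pd 1 f z) := by
  have h := pd_inner (hf.diffAt_pd hz 1) (hf.diffAt_pd hz 1) e
  rw [real_inner_comm (pd e (pd 1 f) z), ← two_mul] at h
  exact h

/-- The inner products of the second and first derivatives. -/
theorem ConformalOn.inner_relations (hz : z ∈ U) :
    inner ℝ (pd 1 (pd 1 f) z) (pd 1 f z) = pd 1 (cfac f) z / 2 ∧
    inner ℝ (pd 1 (pd Complex.I f) z) (pd 1 f z) = pd Complex.I (cfac f) z / 2 ∧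
    inner ℝ (pd Complex.I (pd Complex.I f) z) (pd 1 f z) = -(pd 1 (cfac f) z / 2) ∧
    inner ℝ (pd 1 (pd 1 f) z) (pd Complex.I f z) = -(pd Complex.I (cfac f) z / 2) ∧
    inner ℝ (pd 1 (pd Complex.I f) z) (pd Complex.I f z) = pd 1 (cfac f) z / 2 ∧
    inner ℝ (pd Complex.I (pd Complex.I f) z) (pd Complex.I f z) = pd Complex.I (cfac f) z / 2 := by
  have hc := pd_comm hf.smooth hf.isOpen hz Complex.I 1
  have h1 := hf.pd_cfac hz 1
  have h2 := hf.pd_cfac hz Complex.I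
  have h3 : ∀ e, pd e (cfac f) z =
      2 * inner ℝ (pd e (pd Complex.I f) z) (pd Complex.I f z) := fun e => by
    have h := pd_inner (hf.diffAt_pd hz Complex.I) (hf.diffAt_pd hz Complex.I) e
    rw [real_inner_comm (pd e (pd Complex.I f) z), ← two_mul] at h
    rw [← h]
    exact pd_congr hf.isOpen (fun w hw => (hf.norm_eq w hw).symm) hz e
  have h4 : ∀ e, inner ℝ (pd e (pd 1 f) z) (pd Complex.I f z) +
      inner ℝ (pd e (pd Complex.I f) z) (pd 1 f z) = (0 : ℝ) := fun e => by
    have h := pd_inner (hf.diffAt_pd hz 1) (hf.diffAt_pd hz Complex.I) e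
    rw [real_inner_comm (pd 1 f z) (pd e (pd Complex.I f) z), ← h,
      pd_congr hf.isOpen (fun w hw => hf.inner_eq w hw) hz e, pd_const]
  have h5 := h3 1
  have h6 := h3 Complex.I
  have h7 := h4 1
  have h8 := h4 Complex.I
  rw [hc] at h2 h8
  refine ⟨?_, ?_, ?_, ?_, ?_, ?_⟩ <;> linarith

theorem ConformalOn.eq_zero_of_combination (hz : z ∈ U) {a b : ℝ}
    (h : a • pd 1 f z + b • pd Complex.I f z = 0) : a = 0 ∧ b = 0 := by
  have h1 := congrArg (inner ℝ (pd 1 f z)) h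
  have h2 := congrArg (inner ℝ (pd Complex.I f z)) h
  have h3 : inner ℝ (pd Complex.I f z) (pd 1 f z) = (0 : ℝ) := by
    rw [real_inner_comm, hf.inner_eq z hz]
  have h4 := (hf.cfac_pos hz).ne'
  simp only [inner_add_right, inner_smul_right, hf.inner_eq z hz, hf.norm_eq z hz, h3,
    inner_zero_right, mul_zero, add_zero, zero_add] at h1 h2
  exact ⟨(mul_eq_zero.1 h1).resolve_right h4, (mul_eq_zero.1 h2).resolve_right h4⟩

omit hf in
/-- The equation for the coefficients `p`, `q` of a closed form `P dx + R dy` with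
`P = p fx + q fy` and `R = q fx - p fy`. -/
def DualEq (f : ℂ → E n) (p q : ℂ → ℝ) (z : ℂ) : Prop :=
  q z • (pd 1 (pd 1 f) z - pd Complex.I (pd Complex.I f) z) -
      (2 * p z) • pd 1 (pd Complex.I f) z =
    (pd Complex.I p z - pd 1 q z) • pd 1 f z + (pd Complex.I q z + pd 1 p z) • pd Complex.I f z

/-- Expand `P_y = R_x` by the product rule. The mixed derivative of `f` enters from both sides,
whence the factor `2`. -/
theorem ConformalOn.dualEq {P R : ℂ → E n} {p q : ℂ → ℝ} (hp : ContDiffOn ℝ ∞ p U)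
    (hq : ContDiffOn ℝ ∞ q U)
    (hP : ∀ z ∈ U, P z = p z • pd 1 f z + q z • pd Complex.I f z)
    (hR : ∀ z ∈ U, R z = q z • pd 1 f z - p z • pd Complex.I f z)
    (hz : z ∈ U) (hcl : pd Complex.I P z = pd 1 R z) : DualEq f p q z := by
  have h1 := hf.diffAt_pd hz 1
  have h2 := hf.diffAt_pd hz Complex.I
  have h3 := ContDiffOn.diffAt hp hf.isOpen hz
  have h4 := ContDiffOn.diffAt hq hf.isOpen hz
  have hc := pd_comm hf.smooth hf.isOpen hz Complex.I 1
  rw [pd_congr hf.isOpen hP hz, pd_congr hf.isOpen hR hz, pd_add (h3.fun_smul h1) (h4.fun_smul h2),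
    pd_sub (h4.fun_smul h1) (h3.fun_smul h2), pd_smul h3 h1, pd_smul h4 h2, pd_smul h4 h1,
    pd_smul h3 h2, hc] at hcl
  rw [DualEq, ← sub_eq_zero]
  rw [← sub_eq_zero] at hcl
  rw [← neg_eq_zero, ← hcl]
  module

/-- The Cauchy–Riemann equations for the quadratic differential of a dual form. -/
theorem ConformalOn.differentiableAt_of_dualEq {p q : ℂ → ℝ} (hp : ContDiffOn ℝ ∞ p U)
    (hq : ContDiffOn ℝ ∞ q U) (hz : z ∈ U) (h : DualEq f p q z) :
    DifferentiableAt ℂ (fun w => (((p w * cfac f w / 2 : ℝ)) : ℂ) -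
      ((q w * cfac f w / 2 : ℝ) : ℂ) * Complex.I) z := by
  have h3 := ContDiffOn.diffAt hp hf.isOpen hz
  have h4 := ContDiffOn.diffAt hq hf.isOpen hz
  have h5 := ContDiffOn.diffAt hf.smooth_cfac hf.isOpen hz
  obtain ⟨i1, i2, i3, i4, i5, i6⟩ := hf.inner_relations hz
  have h6 : inner ℝ (pd Complex.I f z) (pd 1 f z) = (0 : ℝ) := by
    rw [real_inner_comm, hf.inner_eq z hz]
  -- Pairing with `f_x` and `f_y` extracts the tangential part, in which conformality turns the
  -- second derivatives of `f` into first derivatives of the conformal factor.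
  have e1 := congrArg (fun v => (inner ℝ v (pd 1 f z) : ℝ)) h
  have e2 := congrArg (fun v => (inner ℝ v (pd Complex.I f z) : ℝ)) h
  simp only [inner_add_left, inner_sub_left, real_inner_smul_left, i1, i2, i3, i4, i5, i6, h6,
    hf.inner_eq z hz, hf.norm_eq z hz] at e1 e2
  change _ = _ * cfac f z + _ at e1
  change _ = _ + _ * cfac f z at e2
  have key : ∀ a : ℂ → ℝ, DifferentiableAt ℝ a z →
      DifferentiableAt ℝ (fun w => a w * cfac f w / 2) z ∧ ∀ e,
      pd e (fun w => a w * cfac f w / 2) z =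
        (pd e a z * cfac f z + a z * pd e (cfac f) z) / 2 := fun a ha => by
    refine ⟨by fun_prop, fun e => ?_⟩
    have := pd_const_smul (2⁻¹ : ℝ) (ha.fun_mul h5) e
    rw [pd_mul ha h5] at this
    simp only [smul_eq_mul] at this
    simpa only [div_eq_inv_mul] using this
  refine differentiableAt_of_cauchyRiemann (key p h3).1 (key q h4).1 ?_ ?_
  · rw [(key p h3).2, (key q h4).2]; linarith
  · rw [(key p h3).2, (key q h4).2]; linarith

end PlaneConformal

/-! ### Totally umbilic conformal immersions -/

section Umbilic

variable {n : ℕ} {U : Set ℂ} {z : ℂ}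

/-- The equation satisfied by the coordinates of a totally umbilic conformal immersion with
conformal factor `exp L`. -/
structure UmbilicAt {V : Type*} [NormedAddCommGroup V] [NormedSpace ℝ V] (L : ℂ → ℝ) (s : ℂ → V)
    (z : ℂ) : Prop where
  diag : pd 1 (pd 1 s) z - pd Complex.I (pd Complex.I s) z =
    pd 1 L z • pd 1 s z - pd Complex.I L z • pd Complex.I s z
  mixed : (2 : ℝ) • pd 1 (pd Complex.I s) z =
    pd Complex.I L z • pd 1 s z + pd 1 L z • pd Complex.I s z

/-- The logarithm of the conformal factor. -/
noncomputable def logFac (f : ℂ → E n) (z : ℂ) : ℝ := Real.log (cfac f z)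

/-- The Laplacian. -/
noncomputable def lap {V : Type*} [NormedAddCommGroup V] [NormedSpace ℝ V] (s : ℂ → V) (z : ℂ) :
    V := pd 1 (pd 1 s) z + pd Complex.I (pd Complex.I s) z

section Conf

variable {f : ℂ → E n} (hf : ConformalOn U f)
include hf

theorem ConformalOn.smooth_logFac : ContDiffOn ℝ ∞ (logFac f) U :=
  hf.smooth_cfac.log fun _ hz => (hf.cfac_pos hz).ne'

theorem ConformalOn.exp_logFac (hz : z ∈ U) : Real.exp (logFac f z) = cfac f z :=
  Real.exp_log (hf.cfac_pos hz)

theorem ConformalOn.pd_logFac (hz : z ∈ U) (e : ℂ) :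
    cfac f z * pd e (logFac f) z = pd e (cfac f) z := by
  have h := ContDiffOn.diffAt hf.smooth_cfac hf.isOpen hz
  have h0 := (hf.cfac_pos hz).ne'
  have h1 : HasFDerivAt (logFac f) _ z := h.hasFDerivAt.log h0
  rw [pd, h1.fderiv, pd]
  simp [mul_inv_cancel_left₀ h0]

/-- Two independent dual forms at a point force it to be umbilic. -/
theorem ConformalOn.umbilicAt {p q p' q' : ℂ → ℝ} (hz : z ∈ U) (h : DualEq f p q z)
    (h' : DualEq f p' q' z) (hne : p z * q' z - q z * p' z ≠ 0) : UmbilicAt (logFac f) f z := by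
  obtain ⟨i1, i2, i3, i4, i5, i6⟩ := hf.inner_relations hz
  have h0 := (hf.cfac_pos hz).ne'
  have hyx : inner ℝ (pd Complex.I f z) (pd 1 f z) = (0 : ℝ) := by
    rw [real_inner_comm, hf.inner_eq z hz]
  -- A tangent vector is recovered from its products with the orthogonal frame `f_x`, `f_y`. It
  -- therefore suffices to know that a combination of second derivatives is tangent; the
  -- coefficients `a`, `b` are then immaterial.
  have span : ∀ (v : E n) (a b : ℝ), v = a • pd 1 f z + b • pd Complex.I f z →
      v = (inner ℝ v (pd 1 f z) / cfac f z) • pd 1 f z +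
        (inner ℝ v (pd Complex.I f z) / cfac f z) • pd Complex.I f z := fun v a b hv => by
    have e1 : inner ℝ v (pd 1 f z) = a * cfac f z := by
      rw [hv, inner_add_left, real_inner_smul_left, real_inner_smul_left, hyx, mul_zero, add_zero]
      rfl
    have e2 : inner ℝ v (pd Complex.I f z) = b * cfac f z := by
      rw [hv, inner_add_left, real_inner_smul_left, real_inner_smul_left, hf.inner_eq z hz,
        mul_zero, zero_add, hf.norm_eq z hz]
      rfl
    rw [e1, e2, mul_div_cancel_right₀ _ h0, mul_div_cancel_right₀ _ h0]
    exact hv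
  have hL : ∀ e, pd e (logFac f) z = pd e (cfac f) z / cfac f z := fun e => by
    rw [← hf.pd_logFac hz e, mul_div_cancel_left₀ _ h0]
  rw [DualEq] at h h'
  constructor
  -- Cramer's rule for the two relations, with determinant `p q' - q p'`.
  · have hv := span (pd 1 (pd 1 f) z - pd Complex.I (pd Complex.I f) z)
      ((p z * q' z - q z * p' z)⁻¹ * (p z * (pd Complex.I p' z - pd 1 q' z) -
        p' z * (pd Complex.I p z - pd 1 q z)))
      ((p z * q' z - q z * p' z)⁻¹ * (p z * (pd Complex.I q' z + pd 1 p' z) -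
        p' z * (pd Complex.I q z + pd 1 p z))) ?_
    · rw [hv, inner_sub_left, inner_sub_left, i1, i3, i4, i6, hL, hL]
      module
    · have e : (p z * q' z - q z * p' z) • (pd 1 (pd 1 f) z - pd Complex.I (pd Complex.I f) z) =
          p z • ((pd Complex.I p' z - pd 1 q' z) • pd 1 f z +
            (pd Complex.I q' z + pd 1 p' z) • pd Complex.I f z) -
          p' z • ((pd Complex.I p z - pd 1 q z) • pd 1 f z +
            (pd Complex.I q z + pd 1 p z) • pd Complex.I f z) := by
        rw [← h, ← h']; module
      rw [← inv_smul_smul₀ hne (pd 1 (pd 1 f) z - pd Complex.I (pd Complex.I f) z), e]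
      module
  · have hv := span ((2 : ℝ) • pd 1 (pd Complex.I f) z)
      ((p z * q' z - q z * p' z)⁻¹ * (q z * (pd Complex.I p' z - pd 1 q' z) -
        q' z * (pd Complex.I p z - pd 1 q z)))
      ((p z * q' z - q z * p' z)⁻¹ * (q z * (pd Complex.I q' z + pd 1 p' z) -
        q' z * (pd Complex.I q z + pd 1 p z))) ?_
    · rw [hv, real_inner_smul_left, real_inner_smul_left, i2, i5, hL, hL]
      module
    · have e : (p z * q' z - q z * p' z) • (2 : ℝ) • pd 1 (pd Complex.I f) z =
          q z • ((pd Complex.I p' z - pd 1 q' z) • pd 1 f z +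
            (pd Complex.I q' z + pd 1 p' z) • pd Complex.I f z) -
          q' z • ((pd Complex.I p z - pd 1 q z) • pd 1 f z +
            (pd Complex.I q z + pd 1 p z) • pd Complex.I f z) := by
        rw [← h, ← h']; module
      rw [← inv_smul_smul₀ hne ((2 : ℝ) • pd 1 (pd Complex.I f) z), e]
      module

end Conf

/-! ### Integrability and energy of the umbilic equations -/

section Codazzi

variable {V : Type*} [NormedAddCommGroup V] [NormedSpace ℝ V] {L : ℂ → ℝ} {s : ℂ → V}

theorem ContDiffOn.lap (hs : ContDiffOn ℝ ∞ s U) (hU : IsOpen U) : ContDiffOn ℝ ∞ (lap s) U :=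
  (ContDiffOn.pd (ContDiffOn.pd hs hU _) hU _).add (ContDiffOn.pd (ContDiffOn.pd hs hU _) hU _)

/-- The Codazzi equation for umbilic immersions. -/
theorem pd_lap_of_umbilic (hU : IsOpen U) (hL : ContDiffOn ℝ ∞ L U) (hs : ContDiffOn ℝ ∞ s U)
    (h : ∀ z ∈ U, UmbilicAt L s z) (hz : z ∈ U) :
    pd 1 (lap s) z = lap L z • pd 1 s z + pd 1 L z • lap s z ∧
    pd Complex.I (lap s) z = lap L z • pd Complex.I s z + pd Complex.I L z • lap s z := by
  have sx := ContDiffOn.pd hs hU 1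
  have sy := ContDiffOn.pd hs hU Complex.I
  have dx := ContDiffOn.diffAt sx hU hz
  have dy := ContDiffOn.diffAt sy hU hz
  have dxx := ContDiffOn.diffAt (ContDiffOn.pd sx hU 1) hU hz
  have dyy := ContDiffOn.diffAt (ContDiffOn.pd sy hU Complex.I) hU hz
  have dxy := ContDiffOn.diffAt (ContDiffOn.pd sy hU 1) hU hz
  have lx := ContDiffOn.diffAt (ContDiffOn.pd hL hU 1) hU hz
  have ly := ContDiffOn.diffAt (ContDiffOn.pd hL hU Complex.I) hU hz
  have hc := pd_comm hs hU hz Complex.I 1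
  have hcL := pd_comm hL hU hz Complex.I 1
  have ediag : ∀ e, pd e (pd 1 (pd 1 s)) z - pd e (pd Complex.I (pd Complex.I s)) z =
      pd e (pd 1 L) z • pd 1 s z + pd 1 L z • pd e (pd 1 s) z -
        (pd e (pd Complex.I L) z • pd Complex.I s z +
          pd Complex.I L z • pd e (pd Complex.I s) z) := fun e => by
    rw [← pd_sub dxx dyy, pd_congr hU (fun w hw => (h w hw).diag) hz e,
      pd_sub (lx.fun_smul dx) (ly.fun_smul dy), pd_smul lx dx, pd_smul ly dy]
  have emix : ∀ e, (2 : ℝ) • pd e (pd 1 (pd Complex.I s)) z =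
      pd e (pd Complex.I L) z • pd 1 s z + pd Complex.I L z • pd e (pd 1 s) z +
        (pd e (pd 1 L) z • pd Complex.I s z + pd 1 L z • pd e (pd Complex.I s) z) := fun e => by
    rw [← pd_const_smul _ dxy, pd_congr hU (fun w hw => (h w hw).mixed) hz e,
      pd_add (ly.fun_smul dx) (lx.fun_smul dy), pd_smul ly dx, pd_smul lx dy]
  have c1 : pd Complex.I (pd 1 (pd Complex.I s)) z = pd 1 (pd Complex.I (pd Complex.I s)) z :=
    pd_comm sy hU hz _ _
  have c2 : pd 1 (pd 1 (pd Complex.I s)) z = pd Complex.I (pd 1 (pd 1 s)) z := by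
    rw [← pd_comm sx hU hz 1 Complex.I]
    exact pd_congr hU (fun w hw => pd_comm hs hU hw _ _) hz 1
  have e1 := ediag 1
  have e2 := emix Complex.I
  have e3 := ediag Complex.I
  have e4 := emix 1
  rw [c1] at e2
  rw [c2] at e4
  rw [hc] at e2 e3
  rw [hcL] at e2 e3
  have a1 : pd 1 (lap s) z = pd 1 (pd 1 (pd 1 s)) z + pd 1 (pd Complex.I (pd Complex.I s)) z :=
    pd_add dxx dyy 1
  have a2 : pd Complex.I (lap s) z =
      pd Complex.I (pd 1 (pd 1 s)) z + pd Complex.I (pd Complex.I (pd Complex.I s)) z :=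
    pd_add dxx dyy Complex.I
  rw [a1, a2]
  simp only [lap]
  rw [sub_eq_iff_eq_add] at e1
  constructor
  -- Write `s_xxx + s_xyy` as `(s_xxx - s_xyy) + 2 s_xyy`; the umbilic equations, differentiated
  -- once, give both terms. The other component is analogous.
  · rw [e1, add_assoc, ← two_smul ℝ (pd 1 (pd Complex.I (pd Complex.I s)) z), e2]
    module
  · rw [sub_eq_iff_eq_add', ← sub_eq_iff_eq_add] at e3
    rw [← e3, ← add_sub_assoc, ← two_smul ℝ (pd Complex.I (pd 1 (pd 1 s)) z), e4]
    module

/-- The mean curvature vector. -/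
theorem pd_meanCurvature (hU : IsOpen U) (hL : ContDiffOn ℝ ∞ L U) (hs : ContDiffOn ℝ ∞ s U)
    (h : ∀ z ∈ U, UmbilicAt L s z) (hz : z ∈ U) :
    pd 1 (fun w => Real.exp (-L w) • lap s w) z = (Real.exp (-L z) * lap L z) • pd 1 s z ∧
    pd Complex.I (fun w => Real.exp (-L w) • lap s w) z =
      (Real.exp (-L z) * lap L z) • pd Complex.I s z := by
  obtain ⟨h1, h2⟩ := pd_lap_of_umbilic hU hL hs h hz
  have dl := ContDiffOn.diffAt (ContDiffOn.lap hs hU) hU hz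
  have dL := ContDiffOn.diffAt hL hU hz
  have dn : DifferentiableAt ℝ (fun w => -L w) z := dL.fun_neg
  have de : DifferentiableAt ℝ (fun w => Real.exp (-L w)) z := dn.exp
  have hn : ∀ e, pd e (fun w => -L w) z = -pd e L z := fun e => by
    simp [pd, fderiv_fun_neg]
  -- The derivative of the factor `exp (-L)` cancels the term `dL · Δs` of the Codazzi equation.
  rw [pd_smul de dl, pd_smul de dl, h1, h2, pd_exp dn, pd_exp dn, hn, hn]
  constructor <;> module

/-- The energy integral for solutions of `Δs = κ e^L s`. -/
theorem energy_const {s : ℂ → ℝ} (hU : IsOpen U) (hc : IsPreconnected U)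
    (hL : ContDiffOn ℝ ∞ L U) (hs : ContDiffOn ℝ ∞ s U) (h : ∀ z ∈ U, UmbilicAt L s z) {κ : ℝ}
    (hκ : ∀ z ∈ U, lap s z = Real.exp (L z) * κ * s z) {z w : ℂ} (hz : z ∈ U) (hw : w ∈ U) :
    Real.exp (-L z) * (pd 1 s z ^ 2 + pd Complex.I s z ^ 2) - κ / 2 * s z ^ 2 =
      Real.exp (-L w) * (pd 1 s w ^ 2 + pd Complex.I s w ^ 2) - κ / 2 * s w ^ 2 := by
  have sx := ContDiffOn.pd hs hU 1
  have sy := ContDiffOn.pd hs hU Complex.I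
  set N : ℂ → ℝ := fun z => Real.exp (-L z) * (pd 1 s z * pd 1 s z + pd Complex.I s z *
    pd Complex.I s z) - κ / 2 * (s z * s z) with hN
  have hNs : ContDiffOn ℝ ∞ N U :=
    (hL.neg.exp.mul ((sx.mul sx).add (sy.mul sy))).sub (contDiffOn_const.mul (hs.mul hs))
  have key : ∀ z ∈ U, pd 1 N z = 0 ∧ pd Complex.I N z = 0 := by
    intro z hz
    have dx := ContDiffOn.diffAt sx hU hz
    have dy := ContDiffOn.diffAt sy hU hz
    have ds := ContDiffOn.diffAt hs hU hz
    have dL := ContDiffOn.diffAt hL hU hz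
    have dn : DifferentiableAt ℝ (fun w => -L w) z := dL.fun_neg
    have de : DifferentiableAt ℝ (fun w => Real.exp (-L w)) z := dn.exp
    have hn : ∀ e, pd e (fun w => -L w) z = -pd e L z := fun e => by
      simp [pd, fderiv_fun_neg]
    have hd : ∀ e, pd e N z = Real.exp (-L z) * -pd e L z * (pd 1 s z * pd 1 s z +
        pd Complex.I s z * pd Complex.I s z) + Real.exp (-L z) *
        (2 * pd 1 s z * pd e (pd 1 s) z + 2 * pd Complex.I s z * pd e (pd Complex.I s) z) -
        κ * s z * pd e s z := fun e => by
      have q1 := (dx.fun_mul dx).fun_add (dy.fun_mul dy)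
      have q2 : DifferentiableAt ℝ (fun w => κ / 2 * (s w * s w)) z :=
        (ds.fun_mul ds).const_mul (κ / 2)
      rw [hN, pd_sub (de.fun_mul q1) q2, pd_mul de q1, pd_add (dx.fun_mul dx) (dy.fun_mul dy),
        pd_mul dx dx, pd_mul dy dy, pd_exp dn, hn]
      have := pd_const_smul (κ / 2) (ds.fun_mul ds) e
      simp only [smul_eq_mul] at this
      rw [this, pd_mul ds ds]
      ring
    have u1 := (h z hz).diag
    have u2 := (h z hz).mixed
    have u3 := hκ z hz
    have hc := pd_comm hs hU hz Complex.I 1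
    simp only [smul_eq_mul, lap] at u1 u2 u3
    have hE : Real.exp (-L z) * Real.exp (L z) = 1 := by rw [← Real.exp_add]; simp
    -- The umbilic equations and the value of `Δs` determine all second derivatives of `s`;
    -- substituting them makes the differential of the energy vanish.
    have xx : pd 1 (pd 1 s) z = (Real.exp (L z) * κ * s z + pd 1 L z * pd 1 s z -
        pd Complex.I L z * pd Complex.I s z) / 2 := by linarith
    have yy : pd Complex.I (pd Complex.I s) z = (Real.exp (L z) * κ * s z - pd 1 L z * pd 1 s z +
        pd Complex.I L z * pd Complex.I s z) / 2 := by linarith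
    have xy : pd 1 (pd Complex.I s) z =
        (pd Complex.I L z * pd 1 s z + pd 1 L z * pd Complex.I s z) / 2 := by linarith
    rw [hd, hd, hc, xx, yy, xy]
    constructor
    · linear_combination (κ * s z * pd 1 s z) * hE
    · linear_combination (κ * s z * pd Complex.I s z) * hE
  have := const_of_pd_eq_zero hU hc hNs (fun z hz => (key z hz).1) (fun z hz => (key z hz).2) hz hw
  simp only [hN] at this
  simp only [sq]
  exact this

end Codazzi

end Umbilic

/-! ### Totally umbilic immersions of plane domains are plane or spherical -/

section PlaneOrSphere

variable {n : ℕ} {U : Set ℂ} {z : ℂ} {f : ℂ → E n}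

theorem pd_pd_eq_zero_of_eventually_const {V : Type*} [NormedAddCommGroup V] [NormedSpace ℝ V]
    {s : ℂ → V} {b : V} (h : ∀ᶠ w in 𝓝 z, s w = b) (e e' : ℂ) :
    pd e s z = 0 ∧ pd e' (pd e s) z = 0 := by
  have key : ∀ {t : ℂ → V} {a : V} {x : ℂ} (e : ℂ), (∀ᶠ w in 𝓝 x, t w = a) → pd e t x = 0 :=
    fun {t a x} e ht => by
      have ht' : t =ᶠ[𝓝 x] fun _ => a := ht
      rw [pd, ht'.fderiv_eq]
      simp
  refine ⟨key e h, key (a := 0) e' ?_⟩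
  filter_upwards [h.eventually_nhds] with w hw
  exact key e hw

section

variable (hf : ConformalOn U f) (hu : ∀ z ∈ U, UmbilicAt (logFac f) f z)
include hf

/-- The Laplacian of a conformal immersion is normal, umbilic or not. -/
theorem ConformalOn.inner_lap (hz : z ∈ U) : inner ℝ (lap f z) (pd 1 f z) = (0 : ℝ) ∧
    inner ℝ (lap f z) (pd Complex.I f z) = (0 : ℝ) := by
  obtain ⟨i1, -, i3, i4, -, i6⟩ := hf.inner_relations hz
  rw [lap, inner_add_left, inner_add_left, i1, i3, i4, i6]
  constructor <;> ring

theorem ConformalOn.pd_pd_inner (v : E n) (hz : z ∈ U) (e e' : ℂ) :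
    pd e' (pd e (fun w => (inner ℝ v (f w) : ℝ))) z = inner ℝ v (pd e' (pd e f) z) := by
  rw [← pd_inner_const v (hf.diffAt_pd hz e)]
  exact pd_congr hf.isOpen (fun w hw => pd_inner_const v (hf.diffAt hw) e) hz e'

/-- For constant `m` orthogonal to `df`, the product with the Laplacian vanishes. -/
theorem ConformalOn.inner_lap_eq_zero {m : E n}
    (h : ∀ z ∈ U, inner ℝ m (pd 1 f z) = (0 : ℝ) ∧ inner ℝ m (pd Complex.I f z) = (0 : ℝ))
    (hz : z ∈ U) : inner ℝ m (lap f z) = (0 : ℝ) := by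
  have key : ∀ e, (∀ z ∈ U, inner ℝ m (pd e f z) = (0 : ℝ)) →
      inner ℝ m (pd e (pd e f) z) = (0 : ℝ) := fun e he => by
    rw [← pd_inner_const m (hf.diffAt_pd hz e), pd_congr hf.isOpen he hz, pd_const]
  rw [lap, inner_add_right, key 1 fun z hz => (h z hz).1, key _ fun z hz => (h z hz).2, add_zero]

theorem ConformalOn.pd_norm_sub (c : E n) (hz : z ∈ U) (e : ℂ) :
    pd e (fun w => (inner ℝ (f w - c) (f w - c) : ℝ)) z = 2 * inner ℝ (f z - c) (pd e f z) := by
  have h1 := (hf.diffAt hz).sub_const c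
  have h2 : pd e (fun w => f w - c) z = pd e f z := by
    rw [pd_sub (hf.diffAt hz) (differentiableAt_const c), pd_const, sub_zero]
  rw [pd_inner h1 h1, h2, real_inner_comm (f z - c) (pd e f z)]
  ring

theorem ConformalOn.pd_inner_sub (c : E n) (hz : z ∈ U) (e : ℂ) :
    pd e (fun w => (inner ℝ (f w - c) (pd e f w) : ℝ)) z =
      inner ℝ (pd e f z) (pd e f z) + inner ℝ (f z - c) (pd e (pd e f) z) := by
  have h1 := (hf.diffAt hz).sub_const c
  have h2 : pd e (fun w => f w - c) z = pd e f z := by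
    rw [pd_sub (hf.diffAt hz) (differentiableAt_const c), pd_const, sub_zero]
  rw [pd_inner h1 (hf.diffAt_pd hz e), h2]

include hu

/-- The curvature is constant and the mean curvature vector is affine in `f`. -/
theorem ConformalOn.exists_lap_eq (hc : IsPreconnected U) :
    ∃ (κ : ℝ) (m : E n), ∀ z ∈ U, lap f z = Real.exp (logFac f z) • (κ • f z + m) := by
  rcases U.eq_empty_or_nonempty with rfl | ⟨z₀, hz₀⟩
  · exact ⟨0, 0, by simp⟩
  have hL := hf.smooth_logFac
  set L := logFac f
  set η : ℂ → E n := fun w => Real.exp (-L w) • lap f w with hη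
  set K : ℂ → ℝ := fun w => Real.exp (-L w) * lap L w with hK
  have hηs : ContDiffOn ℝ ∞ η U := hL.neg.exp.smul (ContDiffOn.lap hf.smooth hf.isOpen)
  have hKs : ContDiffOn ℝ ∞ K U := hL.neg.exp.mul (ContDiffOn.lap hL hf.isOpen)
  have hd : ∀ z ∈ U, pd 1 η z = K z • pd 1 f z ∧ pd Complex.I η z = K z • pd Complex.I f z :=
    fun z hz => pd_meanCurvature hf.isOpen hL hf.smooth hu hz
  -- Cross-differentiating `η_x = K f_x` and `η_y = K f_y` leaves `K_x f_y = K_y f_x`, and `f_x`,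
  -- `f_y` are independent.
  have hK0 : ∀ z ∈ U, pd 1 K z = 0 ∧ pd Complex.I K z = 0 := fun z hz => by
    have dK := ContDiffOn.diffAt hKs hf.isOpen hz
    have e := pd_comm hηs hf.isOpen hz 1 Complex.I
    rw [pd_congr hf.isOpen (fun w hw => (hd w hw).1) hz, pd_congr hf.isOpen
      (fun w hw => (hd w hw).2) hz, pd_smul dK (hf.diffAt_pd hz _),
      pd_smul dK (hf.diffAt_pd hz _), pd_comm hf.smooth hf.isOpen hz Complex.I 1,
      add_left_inj] at e
    have := hf.eq_zero_of_combination hz (a := -pd Complex.I K z) (b := pd 1 K z) (by rw [e]; module)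
    exact ⟨this.2, neg_eq_zero.1 this.1⟩
  have hKc := fun z hz => const_of_pd_eq_zero hf.isOpen hc hKs (fun z hz => (hK0 z hz).1)
    (fun z hz => (hK0 z hz).2) (z := z) hz hz₀
  have hm : ∀ z ∈ U, η z - K z₀ • f z = η z₀ - K z₀ • f z₀ := fun z hz => by
    have hpd : ∀ e, (∀ z ∈ U, pd e η z = K z • pd e f z) → ∀ w ∈ U,
        pd e (fun x => η x - K z₀ • f x) w = 0 := fun e he w hw => by
      rw [pd_sub (ContDiffOn.diffAt hηs hf.isOpen hw) ((hf.diffAt hw).fun_const_smul _),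
        pd_const_smul _ (hf.diffAt hw), he w hw, hKc w hw, sub_self]
    exact const_of_pd_eq_zero hf.isOpen hc (hηs.sub (hf.smooth.const_smul (K z₀)))
      (hpd 1 fun z hz => (hd z hz).1) (hpd _ fun z hz => (hd z hz).2) hz hz₀
  refine ⟨K z₀, η z₀ - K z₀ • f z₀, fun z hz => ?_⟩
  rw [← hm z hz, add_sub_cancel, hη, smul_smul, ← Real.exp_add]
  simp

/-- Plane or spherical form of the Laplacian. -/
theorem ConformalOn.exists_lap_eq_sub (hc : IsPreconnected U) :
    ∃ (κ : ℝ) (c : E n), κ ≤ 0 ∧ (∀ z ∈ U, lap f z = (Real.exp (logFac f z) * κ) • (f z - c)) ∧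
      (κ ≠ 0 → ∀ z ∈ U, κ * inner ℝ (f z - c) (f z - c) = -2 ∧
        inner ℝ (f z - c) (pd 1 f z) = (0 : ℝ) ∧ inner ℝ (f z - c) (pd Complex.I f z) = (0 : ℝ)) := by
  obtain ⟨κ, m, h⟩ := hf.exists_lap_eq hu hc
  by_cases hκ : κ = 0
  · refine ⟨0, 0, le_rfl, fun z hz => ?_, fun h => absurd rfl h⟩
    -- Here `Δf = e^L m` is normal, so the constant `m` is orthogonal to `df`, hence to `Δf`, hence
    -- to itself: `f` is harmonic.
    have h1 : ∀ z ∈ U, inner ℝ m (pd 1 f z) = (0 : ℝ) ∧ inner ℝ m (pd Complex.I f z) = (0 : ℝ) :=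
      fun z hz => by
        have := hf.inner_lap hz
        rw [h z hz, hκ, zero_smul, zero_add, real_inner_smul_left, real_inner_smul_left] at this
        exact ⟨(mul_eq_zero.1 this.1).resolve_left (Real.exp_ne_zero _),
          (mul_eq_zero.1 this.2).resolve_left (Real.exp_ne_zero _)⟩
    have h2 := hf.inner_lap_eq_zero h1 hz
    rw [h z hz, hκ, zero_smul, zero_add, real_inner_smul_right] at h2
    have h3 : m = 0 := inner_self_eq_zero (𝕜 := ℝ).1
      ((mul_eq_zero.1 h2).resolve_left (Real.exp_ne_zero _))
    rw [h z hz, hκ, h3]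
    simp
  · obtain ⟨c, hc'⟩ : ∃ c : E n, ∀ x : E n, κ • x + m = κ • (x - c) :=
      ⟨-(κ⁻¹ • m), fun x => by rw [sub_neg_eq_add, smul_add, smul_smul, mul_inv_cancel₀ hκ, one_smul]⟩
    have h' : ∀ z ∈ U, lap f z = (Real.exp (logFac f z) * κ) • (f z - c) := fun z hz => by
      rw [h z hz, hc', smul_smul]
    have h1 : ∀ z ∈ U, inner ℝ (f z - c) (pd 1 f z) = (0 : ℝ) ∧
        inner ℝ (f z - c) (pd Complex.I f z) = (0 : ℝ) := fun z hz => by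
      have := hf.inner_lap hz
      rw [h' z hz, real_inner_smul_left, real_inner_smul_left] at this
      have hne := mul_ne_zero (Real.exp_ne_zero (logFac f z)) hκ
      exact ⟨(mul_eq_zero.1 this.1).resolve_left hne, (mul_eq_zero.1 this.2).resolve_left hne⟩
    -- Differentiate the orthogonality of `f - c` to `f_x` and `f_y` once more and add. The constant
    -- `κ` is `-2` times the Gauss curvature, so this is the radius of the sphere; it also forces `κ
    -- < 0`.
    have h2 : ∀ z ∈ U, κ * inner ℝ (f z - c) (f z - c) = -2 := fun z hz => by
      have e1 := hf.pd_inner_sub c hz 1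
      have e2 := hf.pd_inner_sub c hz Complex.I
      rw [pd_congr hf.isOpen (fun w hw => (h1 w hw).1) hz, pd_const] at e1
      rw [pd_congr hf.isOpen (fun w hw => (h1 w hw).2) hz, pd_const, hf.norm_eq z hz] at e2
      have e3 : inner ℝ (f z - c) (lap f z) = Real.exp (logFac f z) * κ *
          (inner ℝ (f z - c) (f z - c) : ℝ) := by rw [h' z hz, real_inner_smul_right]
      rw [lap, inner_add_right, hf.exp_logFac hz] at e3
      change 0 = cfac f z + _ at e1
      change 0 = cfac f z + _ at e2
      have h0 := (hf.cfac_pos hz).ne'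
      have : cfac f z * (κ * inner ℝ (f z - c) (f z - c) + 2) = 0 := by linarith
      linarith [(mul_eq_zero.1 this).resolve_left h0]
    -- On an empty domain nothing determines the sign of `κ`, so `0` is taken instead.
    rcases U.eq_empty_or_nonempty with rfl | ⟨z₀, hz₀⟩
    · exact ⟨0, 0, le_rfl, by simp, by simp⟩
    refine ⟨κ, c, ?_, h', fun _ z hz => ⟨h2 z hz, h1 z hz⟩⟩
    by_contra hpos
    have := h2 z₀ hz₀
    have h3 : (0 : ℝ) ≤ inner ℝ (f z₀ - c) (f z₀ - c) := real_inner_self_nonneg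
    nlinarith [mul_nonneg (not_le.1 hpos).le h3]

omit hu in
/-- A linear function that is critical at a point, in the sense of the energy, is constant. -/
theorem ConformalOn.inner_const (hu : ∀ z ∈ U, UmbilicAt (logFac f) f z) (hc : IsPreconnected U)
    {κ : ℝ} {c : E n} (hκ : κ ≤ 0)
    (h : ∀ z ∈ U, lap f z = (Real.exp (logFac f z) * κ) • (f z - c)) {v : E n} {z₀ : ℂ}
    (hz₀ : z₀ ∈ U) (h1 : inner ℝ v (pd 1 f z₀) = (0 : ℝ))
    (h2 : inner ℝ v (pd Complex.I f z₀) = (0 : ℝ)) (h3 : κ * inner ℝ v (f z₀ - c) = 0) {w : ℂ}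
    (hw : w ∈ U) : (inner ℝ v (f w) : ℝ) = inner ℝ v (f z₀) := by
  set s : ℂ → ℝ := fun w => inner ℝ v (f w - c) with hs
  have hss : ContDiffOn ℝ ∞ s U := contDiffOn_const.inner ℝ (hf.smooth.sub contDiffOn_const)
  have d1 : ∀ z ∈ U, ∀ e, pd e s z = inner ℝ v (pd e f z) := fun z hz e => by
    rw [hs, pd_inner_const v ((hf.diffAt hz).sub_const c),
      pd_sub (hf.diffAt hz) (differentiableAt_const c), pd_const, sub_zero]
  have d2 : ∀ z ∈ U, ∀ e e', pd e' (pd e s) z = inner ℝ v (pd e' (pd e f) z) := fun z hz e e' => by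
    rw [pd_congr hf.isOpen (fun w hw => d1 w hw e) hz, pd_inner_const v (hf.diffAt_pd hz e)]
  have us : ∀ z ∈ U, UmbilicAt (logFac f) s z := fun z hz => by
    constructor
    · rw [d2 z hz, d2 z hz, d1 z hz, d1 z hz, ← inner_sub_right, (hu z hz).diag, inner_sub_right,
        real_inner_smul_right, real_inner_smul_right]
      rfl
    · rw [d2 z hz, d1 z hz, d1 z hz, smul_eq_mul, ← real_inner_smul_right, (hu z hz).mixed,
        inner_add_right, real_inner_smul_right, real_inner_smul_right]
      rfl
  have ls : ∀ z ∈ U, lap s z = Real.exp (logFac f z) * κ * s z := fun z hz => by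
    rw [lap, d2 z hz, d2 z hz, ← inner_add_right]
    change inner ℝ v (lap f z) = _
    rw [h z hz, real_inner_smul_right]
  -- The energy vanishes at `z₀`, hence everywhere, and `κ ≤ 0` makes both of its terms nonnegative.
  have hN : ∀ w ∈ U, pd 1 s w = 0 ∧ pd Complex.I s w = 0 := fun w hw => by
    have hE := energy_const hf.isOpen hc hf.smooth_logFac hss us ls hw hz₀
    have h3' : κ * s z₀ = 0 := h3
    have h4 : κ / 2 * s z₀ ^ 2 = 0 := by linear_combination s z₀ / 2 * h3'
    rw [d1 z₀ hz₀, d1 z₀ hz₀, h1, h2, h4] at hE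
    have e0 := Real.exp_pos (-logFac f w)
    have hk : 0 ≤ -(κ / 2 * s w ^ 2) := by nlinarith [sq_nonneg (s w)]
    have hs0 : 0 ≤ pd 1 s w ^ 2 + pd Complex.I s w ^ 2 := by positivity
    have hs1 : pd 1 s w ^ 2 + pd Complex.I s w ^ 2 = 0 := by
      have : Real.exp (-logFac f w) * (pd 1 s w ^ 2 + pd Complex.I s w ^ 2) = 0 := by
        have := mul_nonneg e0.le hs0
        linarith
      exact (mul_eq_zero.1 this).resolve_left e0.ne'
    constructor <;> nlinarith [sq_nonneg (pd 1 s w), sq_nonneg (pd Complex.I s w)]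
  have := const_of_pd_eq_zero hf.isOpen hc hss (fun w hw => (hN w hw).1) (fun w hw => (hN w hw).2)
    hw hz₀
  simp only [hs, inner_sub_right] at this
  linarith

/-- Unique continuation for the coordinates. -/
theorem ConformalOn.inner_eq_of_eventually (hc : IsPreconnected U) {v : E n} {b : ℝ} (hz : z ∈ U)
    (h : ∀ᶠ w in 𝓝 z, inner ℝ v (f w) = b) {w : ℂ} (hw : w ∈ U) : inner ℝ v (f w) = b := by
  obtain ⟨κ, c, hκ, h1, -⟩ := hf.exists_lap_eq_sub hu hc
  rw [← h.self_of_nhds]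
  have q := fun e e' => pd_pd_eq_zero_of_eventually_const h e e'
  refine hf.inner_const hu hc hκ h1 hz ?_ ?_ ?_ hw
  · rw [← pd_inner_const v (hf.diffAt hz)]; exact (q 1 1).1
  · rw [← pd_inner_const v (hf.diffAt hz)]; exact (q _ 1).1
  · have e1 : inner ℝ v (lap f z) = (0 : ℝ) := by
      rw [lap, inner_add_right, ← hf.pd_pd_inner v hz, ← hf.pd_pd_inner v hz, (q _ _).2, (q _ _).2,
        add_zero]
    rw [h1 z hz, real_inner_smul_right, mul_assoc] at e1
    exact (mul_eq_zero.1 e1).resolve_left (Real.exp_ne_zero _)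

/-- Unique continuation for spheres. -/
theorem ConformalOn.norm_sub_eq_of_eventually (hc : IsPreconnected U) {c₀ : E n} {b : ℝ}
    (hz : z ∈ U) (h : ∀ᶠ w in 𝓝 z, inner ℝ (f w - c₀) (f w - c₀) = b) {w : ℂ} (hw : w ∈ U) :
    inner ℝ (f w - c₀) (f w - c₀) = b := by
  obtain ⟨κ, c, hκ, h1, h2⟩ := hf.exists_lap_eq_sub hu hc
  by_cases h0 : κ = 0
  -- A harmonic `f` cannot stay on a sphere even locally: the Laplacian of `|f - c₀|²` would be four
  -- times the conformal factor, which is positive.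
  · exfalso
    have q : ∀ e, inner ℝ (pd e f z) (pd e f z) + inner ℝ (f z - c₀) (pd e (pd e f) z) = (0 : ℝ) :=
      fun e => by
        have q1 := (pd_pd_eq_zero_of_eventually_const h e e).2
        rw [pd_congr hf.isOpen (fun w hw => hf.pd_norm_sub c₀ hw e) hz] at q1
        have q2 := pd_const_smul (2 : ℝ) (((hf.diffAt hz).sub_const c₀).inner ℝ
          (hf.diffAt_pd hz e)) e
        simp only [smul_eq_mul] at q2
        rw [q2, hf.pd_inner_sub c₀ hz e] at q1
        linarith
    have q1 := q 1
    have q2 := q Complex.I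
    have q3 : inner ℝ (f z - c₀) (lap f z) = (0 : ℝ) := by rw [h1 z hz, h0]; simp
    rw [lap, inner_add_right] at q3
    rw [hf.norm_eq z hz] at q2
    have := hf.cfac_pos hz
    rw [cfac] at this
    linarith
  · have h3 : ∀ w ∈ U, (inner ℝ (f w - c) (f w - c) : ℝ) = -2 / κ := fun w hw => by
      rw [eq_div_iff h0, mul_comm]; exact (h2 h0 w hw).1
    -- On the sphere about `c` the function `|f - c₀|²` is affine in `f`, so unique continuation for
    -- linear functions applies.
    have h4 : ∀ w ∈ U, (inner ℝ (f w - c₀) (f w - c₀) : ℝ) =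
        2 * inner ℝ (c - c₀) (f w) + (-2 / κ - inner ℝ c c + inner ℝ c₀ c₀) := fun w hw => by
      have := h3 w hw
      simp only [inner_sub_left, inner_sub_right, real_inner_comm (f w) c,
        real_inner_comm (f w) c₀] at this ⊢
      linarith
    have h5 : ∀ᶠ w in 𝓝 z, inner ℝ (c - c₀) (f w) =
        (b - (-2 / κ - inner ℝ c c + inner ℝ c₀ c₀)) / 2 := by
      filter_upwards [h, hf.isOpen.mem_nhds hz] with w hw hwU
      have := h4 w hwU
      linarith
    have := hf.inner_eq_of_eventually hu hc hz h5 hw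
    have := h4 w hw
    linarith

end

end PlaneOrSphere

/-! ### The form `g⁻¹ df' g⁻¹` of a Darboux pair is closed -/

section Closed

variable {n : ℕ} {U : Set ℂ} {z : ℂ} {f f' : ℂ → E n}

/-- The derivative of `invConj g h` in `g`, in direction `k`. -/
noncomputable def dInvConj (g k h : E n) : E n :=
  (-(2 * (inner ℝ g g : ℝ)⁻¹ ^ 2 * inner ℝ g k)) • h +
    (8 * (inner ℝ g g : ℝ)⁻¹ ^ 3 * inner ℝ g k * inner ℝ g h -
      2 * (inner ℝ g g : ℝ)⁻¹ ^ 2 * inner ℝ k h) • g -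
    (2 * (inner ℝ g g : ℝ)⁻¹ ^ 2 * inner ℝ g h) • k

theorem pd_invConj {g h : ℂ → E n} (hg : DifferentiableAt ℝ g z) (hh : DifferentiableAt ℝ h z)
    (h0 : g z ≠ 0) (e : ℂ) : pd e (fun w => invConj (g w) (h w)) z =
      dInvConj (g z) (pd e g z) (h z) + invConj (g z) (pd e h z) := by
  have h3 : (inner ℝ (g z) (g z) : ℝ) ≠ 0 := by simpa using h0
  have d1 : DifferentiableAt ℝ (fun w => (inner ℝ (g w) (g w) : ℝ)) z := hg.inner ℝ hg
  have d2 : DifferentiableAt ℝ (fun w => (inner ℝ (g w) (g w) : ℝ)⁻¹) z := d1.fun_inv h3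
  have d3 : DifferentiableAt ℝ (fun w => (inner ℝ (g w) (h w) : ℝ)) z := hg.inner ℝ hh
  have d4 : DifferentiableAt ℝ (fun w => (inner ℝ (g w) (g w) : ℝ)⁻¹ *
    (inner ℝ (g w) (g w) : ℝ)⁻¹) z := d2.fun_mul d2
  have d5 : DifferentiableAt ℝ (fun w => (inner ℝ (g w) (g w) : ℝ)⁻¹ *
    (inner ℝ (g w) (g w) : ℝ)⁻¹ * inner ℝ (g w) (h w)) z := d4.fun_mul d3
  have e1 : (fun w => invConj (g w) (h w)) = fun w => (inner ℝ (g w) (g w) : ℝ)⁻¹ • h w -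
      (2 : ℝ) • (((inner ℝ (g w) (g w) : ℝ)⁻¹ * (inner ℝ (g w) (g w) : ℝ)⁻¹ *
        inner ℝ (g w) (h w)) • g w) := by
    funext w
    simp only [invConj, smul_smul]
    congr 2
    ring
  rw [e1, pd_sub (d2.fun_smul hh) ((d5.fun_smul hg).fun_const_smul (2 : ℝ)),
    pd_const_smul _ (d5.fun_smul hg), pd_smul d2 hh, pd_smul d5 hg, pd_mul d4 d3, pd_mul d2 d2,
    pd_inv d1 h3, pd_inner hg hg, pd_inner hg hh, invConj, dInvConj,
    real_inner_comm (g z) (pd e g z)]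
  match_scalars <;> ring

/-- The inverse of `v ↦ g⁻¹ v g⁻¹` is `v ↦ g v g`. -/
theorem eq_of_invConj_eq {g X P : E n} (hg : g ≠ 0) (h : invConj g X = P) :
    X = (inner ℝ g g : ℝ) • P - (2 * inner ℝ g P : ℝ) • g := by
  have h3 : (inner ℝ g g : ℝ) ≠ 0 := by simpa using hg
  have h1 : inner ℝ g P = -((inner ℝ g g : ℝ)⁻¹ * inner ℝ g X) := by
    rw [← h, invConj, inner_sub_right, inner_smul_right, inner_smul_right]
    field_simp
    ring
  rw [h1, ← h, invConj]
  match_scalars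
  · field_simp
  · field_simp
    ring

/-- The heart of the closedness of `g⁻¹ df' g⁻¹`: the terms in which `g` is differentiated, with `dg
= df' - df`, are symmetric in the two directions. `X` and `Y` are expressed through `A`, `B` and
`g`, after which only an identity between inner products is left. -/
theorem dInvConj_symm {A B g X Y : E n} {p q : ℝ} (hAB : inner ℝ A B = (0 : ℝ))
    (hE : (inner ℝ B B : ℝ) = inner ℝ A A) (hg : g ≠ 0) (hX : invConj g X = p • A + q • B)
    (hY : invConj g Y = q • A - p • B) : dInvConj g (Y - B) X = dInvConj g (X - A) Y := by
  have h3 : (inner ℝ g g : ℝ) ≠ 0 := by simpa using hg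
  have hX' := eq_of_invConj_eq hg hX
  have hY' := eq_of_invConj_eq hg hY
  clear hX hY
  have hBA : inner ℝ B A = (0 : ℝ) := by rw [real_inner_comm, hAB]
  have hAg : (inner ℝ A g : ℝ) = inner ℝ g A := real_inner_comm _ _
  have hBg : (inner ℝ B g : ℝ) = inner ℝ g B := real_inner_comm _ _
  rw [inner_add_right, inner_smul_right, inner_smul_right] at hX'
  rw [inner_sub_right, inner_smul_right, inner_smul_right] at hY'
  subst hX' hY'
  simp only [dInvConj, inner_sub_left, inner_sub_right, inner_add_left, inner_add_right,
    inner_smul_left, inner_smul_right, hAB, hBA, hAg, hBg, hE, conj_trivial]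
  generalize (inner ℝ g g : ℝ) = ρ at h3 ⊢
  generalize (inner ℝ g A : ℝ) = a
  generalize (inner ℝ g B : ℝ) = b
  generalize (inner ℝ A A : ℝ) = E
  match_scalars <;> field_simp <;> ring

/-- The coefficients of a closed vector valued form that is dual to a conformal immersion. -/
theorem ConformalOn.exists_dual (hf : ConformalOn U f) {P R : ℂ → E n}
    (hP : ContDiffOn ℝ ∞ P U) (hR : ContDiffOn ℝ ∞ R U)
    (hw : ∀ z ∈ U, ι n (pd 1 f z) * ι n (R z) - ι n (pd Complex.I f z) * ι n (P z) = 0) :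
    ∃ p q : ℂ → ℝ, ContDiffOn ℝ ∞ p U ∧ ContDiffOn ℝ ∞ q U ∧
      (∀ z ∈ U, P z = p z • pd 1 f z + q z • pd Complex.I f z) ∧
      (∀ z ∈ U, R z = q z • pd 1 f z - p z • pd Complex.I f z) ∧
      (∀ z ∈ U, qcoeff (pd 1 f z) (pd Complex.I f z) (P z) (R z) =
        ((p z * cfac f z / 2 : ℝ) : ℂ) - ((q z * cfac f z / 2 : ℝ) : ℂ) * Complex.I) := by
  have fx := ContDiffOn.pd hf.smooth hf.isOpen 1
  have h0 : ∀ z ∈ U, cfac f z ≠ 0 := fun z hz => (hf.cfac_pos hz).ne'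
  refine ⟨fun z => inner ℝ (pd 1 f z) (P z) / cfac f z,
    fun z => inner ℝ (pd 1 f z) (R z) / cfac f z, (fx.inner ℝ hP).div hf.smooth_cfac h0,
    (fx.inner ℝ hR).div hf.smooth_cfac h0, fun z hz => ?_, fun z hz => ?_, fun z hz => ?_⟩
  · exact (eq_of_wedge_eq_zero (hf.inner_eq z hz) (hf.norm_eq z hz) (hf.ne_zero z hz) (hw z hz)).1
  · exact (eq_of_wedge_eq_zero (hf.inner_eq z hz) (hf.norm_eq z hz) (hf.ne_zero z hz) (hw z hz)).2
  · rw [qcoeff_of_wedge (hf.ne_zero z hz) (conformal_iff.2 ⟨hf.norm_eq z hz, hf.inner_eq z hz⟩)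
      (hw z hz), div_mul_cancel₀ _ (h0 z hz), div_mul_cancel₀ _ (h0 z hz)]

theorem ContDiffOn.invConj {g h : ℂ → E n} (hg : ContDiffOn ℝ ∞ g U) (hh : ContDiffOn ℝ ∞ h U)
    (h0 : ∀ z ∈ U, g z ≠ 0) : ContDiffOn ℝ ∞ (fun z => invConj (g z) (h z)) U := by
  have h1 : ContDiffOn ℝ ∞ (fun z => (inner ℝ (g z) (g z) : ℝ)⁻¹) U :=
    (hg.inner ℝ hg).inv fun z hz => by simpa using h0 z hz
  exact (h1.smul hh).sub (((contDiffOn_const.mul (h1.pow 2)).mul (hg.inner ℝ hh)).smul hg)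

/-- The form `g⁻¹ df' g⁻¹` of a Darboux pair is dual to `df`. -/
theorem ConformalOn.exists_dual_pair (hf : ConformalOn U f) (hf' : ContDiffOn ℝ ∞ f' U)
    (hne : ∀ z ∈ U, f' z - f z ≠ 0)
    (hw : ∀ z ∈ U, ι n (pd 1 f z) * ι n (invConj (f' z - f z) (pd Complex.I f' z)) -
      ι n (pd Complex.I f z) * ι n (invConj (f' z - f z) (pd 1 f' z)) = 0) :
    ∃ p q : ℂ → ℝ, ContDiffOn ℝ ∞ p U ∧ ContDiffOn ℝ ∞ q U ∧ (∀ z ∈ U, DualEq f p q z) ∧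
      ∀ z ∈ U, qcoeff (pd 1 f z) (pd Complex.I f z) (invConj (f' z - f z) (pd 1 f' z))
        (invConj (f' z - f z) (pd Complex.I f' z)) =
        ((p z * cfac f z / 2 : ℝ) : ℂ) - ((q z * cfac f z / 2 : ℝ) : ℂ) * Complex.I := by
  have hg : ContDiffOn ℝ ∞ (fun z => f' z - f z) U := hf'.sub hf.smooth
  have sx := ContDiffOn.pd hf' hf.isOpen 1
  have sy := ContDiffOn.pd hf' hf.isOpen Complex.I
  obtain ⟨p, q, hp, hq, hP, hR, hQ⟩ := hf.exists_dual (ContDiffOn.invConj hg sx hne)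
    (ContDiffOn.invConj hg sy hne) hw
  refine ⟨p, q, hp, hq, fun z hz => hf.dualEq hp hq hP hR hz ?_, hQ⟩
  have dg := ContDiffOn.diffAt hg hf.isOpen hz
  have hge : ∀ e, pd e (fun z => f' z - f z) z = pd e f' z - pd e f z :=
    pd_sub (ContDiffOn.diffAt hf' hf.isOpen hz) (hf.diffAt hz)
  rw [pd_invConj dg (ContDiffOn.diffAt sx hf.isOpen hz) (hne z hz),
    pd_invConj dg (ContDiffOn.diffAt sy hf.isOpen hz) (hne z hz), hge, hge,
    pd_comm hf' hf.isOpen hz Complex.I 1,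
    dInvConj_symm (hf.inner_eq z hz) (hf.norm_eq z hz) (hne z hz) (hP z hz) (hR z hz)]

/-- The differential of a Christoffel transform is dual to `df`. -/
theorem ConformalOn.exists_dual_christoffel (hf : ConformalOn U f) (hf' : ContDiffOn ℝ ∞ f' U)
    (hw : ∀ z ∈ U, ι n (pd 1 f z) * ι n (pd Complex.I f' z) -
      ι n (pd Complex.I f z) * ι n (pd 1 f' z) = 0) :
    ∃ p q : ℂ → ℝ, ContDiffOn ℝ ∞ p U ∧ ContDiffOn ℝ ∞ q U ∧ (∀ z ∈ U, DualEq f p q z) ∧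
      ∀ z ∈ U, qcoeff (pd 1 f z) (pd Complex.I f z) (pd 1 f' z) (pd Complex.I f' z) =
        ((p z * cfac f z / 2 : ℝ) : ℂ) - ((q z * cfac f z / 2 : ℝ) : ℂ) * Complex.I := by
  obtain ⟨p, q, hp, hq, hP, hR, hQ⟩ := hf.exists_dual (ContDiffOn.pd hf' hf.isOpen 1)
    (ContDiffOn.pd hf' hf.isOpen Complex.I) hw
  exact ⟨p, q, hp, hq, fun z hz => hf.dualEq hp hq hP hR hz (pd_comm hf' hf.isOpen hz _ _), hQ⟩

end Closed

/-! ### Uniqueness of the spectral parameter -/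

/-- A holomorphic function with real values is locally constant by the Cauchy–Riemann equations;
here the function is `b / a`. -/
theorem exists_real_of_im_eq_zero {a b : ℂ → ℂ} {U : Set ℂ} (hU : IsOpen U)
    (ha : DifferentiableOn ℂ a U) (hb : DifferentiableOn ℂ b U) {z₀ : ℂ} (hz₀ : z₀ ∈ U)
    (h0 : a z₀ ≠ 0) (him : ∀ᶠ z in 𝓝 z₀, (b z / a z).im = 0) :
    ∃ r : ℝ, ∀ᶠ z in 𝓝 z₀, b z = r * a z := by
  have hne : ∀ᶠ z in 𝓝 z₀, a z ≠ 0 :=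
    (ha.differentiableAt (hU.mem_nhds hz₀)).continuousAt.eventually_ne h0
  obtain ⟨ε, hε, hB⟩ := Metric.eventually_nhds_iff_ball.1
    ((hU.eventually_mem hz₀).and (hne.and him))
  have hd : DifferentiableOn ℂ (fun z => b z / a z) (Metric.ball z₀ ε) := fun z hz =>
    (((hb.differentiableAt (hU.mem_nhds (hB z hz).1)).div
      (ha.differentiableAt (hU.mem_nhds (hB z hz).1)) (hB z hz).2.1)).differentiableWithinAt
  have hfd : ∀ z ∈ Metric.ball z₀ ε, fderiv ℝ (fun z => b z / a z) z = 0 := fun z hz => by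
    have hda := hd.differentiableAt (Metric.isOpen_ball.mem_nhds hz)
    obtain ⟨h1, h2⟩ := differentiableAt_complex_iff_differentiableAt_real.1 hda
    have h3 : ∀ X, (fderiv ℝ (fun z => b z / a z) z X).im = 0 := fun X => by
      have e1 : HasFDerivAt (fun z => (b z / a z).im) _ z :=
        Complex.imCLM.hasFDerivAt.comp z h1.hasFDerivAt
      have e2 : (fun z => (b z / a z).im) =ᶠ[𝓝 z] fun _ => 0 := by
        filter_upwards [Metric.isOpen_ball.mem_nhds hz] with w hw
        exact (hB w hw).2.2
      have e3 := e1.fderiv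
      rw [e2.fderiv_eq] at e3
      have := DFunLike.congr_fun e3 X
      simpa using this.symm
    have h4 : (fderiv ℝ (fun z => b z / a z) z 1).re = 0 := by
      have := h3 Complex.I
      rw [h2] at this
      simpa using this
    have h5 : fderiv ℝ (fun z => b z / a z) z 1 = 0 := Complex.ext h4 (h3 1)
    refine clm_ext_one_I h5 ?_
    rw [h2, h5, smul_zero]; rfl
  refine ⟨(b z₀ / a z₀).re, Metric.eventually_nhds_iff_ball.2 ⟨ε, hε, fun z hz => ?_⟩⟩
  have h6 : b z / a z = b z₀ / a z₀ := Metric.isOpen_ball.is_const_of_fderiv_eq_zero (𝕜 := ℝ)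
    (convex_ball _ _).isPreconnected (hd.restrictScalars ℝ) hfd hz (Metric.mem_ball_self hε)
  have h7 : (((b z₀ / a z₀).re : ℝ) : ℂ) = b z₀ / a z₀ :=
    Complex.ext (by simp) (by simpa using (him.self_of_nhds).symm)
  rw [h7, ← h6, div_mul_cancel₀ _ (hB z hz).2.1]

/-! ### From charts to the Riemann surface -/

section Global

variable {M : Type*} [TopologicalSpace M] [ChartedSpace ℂ M] [IsManifold 𝓘(ℂ, ℂ) ω M] {n : ℕ}
  {Q : Polarisation M} {f f' fc : M → E n}

theorem IsConformalImmersion.conformalOn (hf : IsConformalImmersion f)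
    {φ : OpenPartialHomeomorph M ℂ} (hφ : φ ∈ atlas ℂ M) :
    ConformalOn φ.target (f ∘ φ.symm) := by
  have hpd : ∀ z ∈ φ.target, ∀ e, pd e (f ∘ φ.symm) z = dC f (φ.symm z) (coordField φ z * e) :=
    fun z hz e => fderiv_comp_symm hf.smooth hφ hz e
  have hc : ∀ z ∈ φ.target, qcoeff (pd 1 (f ∘ φ.symm) z) (pd Complex.I (f ∘ φ.symm) z)
      (pd 1 (f ∘ φ.symm) z) (pd Complex.I (f ∘ φ.symm) z) = 0 := fun z hz => by
    rw [hpd z hz, hpd z hz, mul_one, qcoeff_comp_mul, hf.qcoeff_eq_zero, zero_mul]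
  refine ⟨φ.open_target, hf.smooth.contDiffOn_comp_symm hφ, fun z hz => ?_,
    fun z hz => (conformal_iff.1 (hc z hz)).1, fun z hz => (conformal_iff.1 (hc z hz)).2⟩
  rw [hpd z hz, mul_one]
  exact hf.dC_ne_zero _ (coordField_ne_zero hφ hz)

/-- The quadratic differential of a Darboux pair. -/
noncomputable def pairDiff (f f' : M → E n) (p : M) : ℂ :=
  qcoeff (dC f p 1) (dC f p Complex.I) (pairForm f f' p 1) (pairForm f f' p Complex.I)

/-- The factor `coordField φ z ^ 2` converts the coefficient from the preferred chart at the point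
to the chart `φ`, where `p`, `q` live. -/
theorem exists_dual_pairDiff (hf : IsConformalImmersion f) (h : IsDarbouxPair ℂ f f')
    {φ : OpenPartialHomeomorph M ℂ} (hφ : φ ∈ atlas ℂ M) :
    ∃ p q : ℂ → ℝ, ContDiffOn ℝ ∞ p φ.target ∧ ContDiffOn ℝ ∞ q φ.target ∧
      (∀ z ∈ φ.target, DualEq (f ∘ φ.symm) p q z) ∧
      ∀ z ∈ φ.target, pairDiff f f' (φ.symm z) * coordField φ z ^ 2 =
        ((p z * cfac (f ∘ φ.symm) z / 2 : ℝ) : ℂ) -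
          ((q z * cfac (f ∘ φ.symm) z / 2 : ℝ) : ℂ) * Complex.I := by
  have hpd : ∀ z ∈ φ.target, ∀ e, pd e (f ∘ φ.symm) z = dC f (φ.symm z) (coordField φ z * e) :=
    fun z hz e => fderiv_comp_symm hf.smooth hφ hz e
  have hpd' : ∀ z ∈ φ.target, ∀ e, invConj ((f' ∘ φ.symm) z - (f ∘ φ.symm) z)
      (pd e (f' ∘ φ.symm) z) = pairForm f f' (φ.symm z) (coordField φ z * e) := fun z hz e => by
    rw [pairForm_apply, ← fderiv_comp_symm h.smooth' hφ hz e]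
    rfl
  obtain ⟨p, q, hp, hq, hd, hQ⟩ := (hf.conformalOn hφ).exists_dual_pair
    (h.smooth'.contDiffOn_comp_symm hφ) (fun z _ => sub_ne_zero.2 (h.ne (φ.symm z)).symm)
    (fun z hz => by
      rw [hpd' z hz, hpd' z hz, hpd z hz, hpd z hz]
      exact h.wedge_pairForm _ _ _)
  refine ⟨p, q, hp, hq, hd, fun z hz => ?_⟩
  rw [← hQ z hz, hpd' z hz, hpd' z hz, hpd z hz, hpd z hz, mul_one, qcoeff_comp_mul]
  rfl

theorem exists_dual_christoffel (hf : IsConformalImmersion f) (h : IsChristoffel Q f fc)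
    {φ : OpenPartialHomeomorph M ℂ} (hφ : φ ∈ atlas ℂ M) :
    ∃ p q : ℂ → ℝ, ContDiffOn ℝ ∞ p φ.target ∧ ContDiffOn ℝ ∞ q φ.target ∧
      (∀ z ∈ φ.target, DualEq (f ∘ φ.symm) p q z) ∧
      ∀ z ∈ φ.target, Q.coeff (φ.symm z) * coordField φ z ^ 2 =
        ((p z * cfac (f ∘ φ.symm) z / 2 : ℝ) : ℂ) -
          ((q z * cfac (f ∘ φ.symm) z / 2 : ℝ) : ℂ) * Complex.I := by
  have hpd : ∀ z ∈ φ.target, ∀ e, pd e (f ∘ φ.symm) z = dC f (φ.symm z) (coordField φ z * e) :=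
    fun z hz e => fderiv_comp_symm hf.smooth hφ hz e
  have hpd' : ∀ z ∈ φ.target, ∀ e, pd e (fc ∘ φ.symm) z = dC fc (φ.symm z) (coordField φ z * e) :=
    fun z hz e => fderiv_comp_symm h.smooth hφ hz e
  obtain ⟨p, q, hp, hq, hd, hQ⟩ := (hf.conformalOn hφ).exists_dual_christoffel
    (h.smooth.contDiffOn_comp_symm hφ)
    (fun z hz => by
      rw [hpd' z hz, hpd' z hz, hpd z hz, hpd z hz]
      exact h.wedge _ (coordField φ z * 1 : ℂ) (coordField φ z * Complex.I : ℂ))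
  refine ⟨p, q, hp, hq, hd, fun z hz => ?_⟩
  rw [← hQ z hz, hpd' z hz, hpd' z hz, hpd z hz, hpd z hz, mul_one, qcoeff_comp_mul, h.qcoeff_eq]

/-- The form `g⁻¹ df' g⁻¹` is closed, and the tangential part of closedness is the Cauchy–Riemann
system. -/
theorem pairDiff_holomorphic (hf : IsConformalImmersion f) (h : IsDarbouxPair ℂ f f')
    {φ : OpenPartialHomeomorph M ℂ} (hφ : φ ∈ atlas ℂ M) :
    DifferentiableOn ℂ (fun z => pairDiff f f' (φ.symm z) * coordField φ z ^ 2) φ.target := by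
  obtain ⟨p, q, hp, hq, hd, hQ⟩ := exists_dual_pairDiff hf h hφ
  intro z hz
  exact ((hf.conformalOn hφ).differentiableAt_of_dualEq hp hq hz
    (hd z hz)).differentiableWithinAt.congr hQ (hQ z hz)

/-- If the two quadratic differentials are not real proportional, `f` is totally umbilic. -/
theorem umbilicAt_of_not_proportional [PreconnectedSpace M] (hf : IsConformalImmersion f)
    (h : IsDarbouxPair ℂ f f') (hc : IsChristoffel Q f fc)
    (hr : ¬ ∃ r : ℝ, ∀ p, pairDiff f f' p = r * Q.coeff p) {φ : OpenPartialHomeomorph M ℂ}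
    (hφ : φ ∈ atlas ℂ M) {z : ℂ} (hz : z ∈ φ.target) :
    UmbilicAt (logFac (f ∘ φ.symm)) (f ∘ φ.symm) z := by
  have hF := hf.conformalOn hφ
  have hU := hF.isOpen
  set F := f ∘ φ.symm with hFdef
  obtain ⟨p, q, hp, hq, hd, hQ⟩ := exists_dual_christoffel hf hc hφ
  obtain ⟨p', q', hp', hq', hd', hQ'⟩ := exists_dual_pairDiff hf h hφ
  -- Up to a positive factor and sign, the determinant is the imaginary part of one differential
  -- times the conjugate of the other; `S` is where the two are real independent.
  set S : Set ℂ := {w | w ∈ φ.target ∧ p w * q' w - q w * p' w ≠ 0} with hS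
  have hSu : ∀ w ∈ S, UmbilicAt (logFac F) F w := fun w hw =>
    hF.umbilicAt hw.1 (hd w hw.1) (hd' w hw.1) hw.2
  have hdense : z ∈ closure S := by
    by_contra hcl
    have h1 : ∀ᶠ w in 𝓝 z, p w * q' w - q w * p' w = 0 := by
      rw [mem_closure_iff_nhds'] at hcl
      push Not at hcl
      obtain ⟨t, ht, hts⟩ := hcl
      filter_upwards [ht, hU.mem_nhds hz] with w hw hwU
      by_contra hne
      exact hts ⟨w, hwU, hne⟩ hw
    -- The quotient needs a nonzero denominator. `Q` may vanish at `z`, but not on a neighbourhood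
    -- of it, so one moves to a nearby point `z₁`.
    have h2 : ∃ᶠ w in 𝓝 z, Q.coeff (φ.symm w) ≠ 0 := by
      intro h2
      simp only [ne_eq, not_not] at h2
      have h3 : ∀ᶠ x in 𝓝 (φ.symm z), Q.coeff x = 0 := by
        have hx : φ.symm z ∈ φ.source := φ.map_target hz
        have h4 := (φ.continuousAt hx)
        rw [ContinuousAt, φ.right_inv hz] at h4
        filter_upwards [h4.eventually h2, φ.open_source.mem_nhds hx] with x hx1 hx2
        rwa [φ.left_inv hx2] at hx1
      obtain ⟨x, hx⟩ := Q.ne_zero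
      exact hx (quadDiff_eq_zero Q.holomorphic h3 x)
    obtain ⟨z₁, hz₁, h1', hz₁U⟩ :=
      (h2.and_eventually (h1.eventually_nhds.and (hU.eventually_mem hz))).exists
    have hc1 := coordField_ne_zero hφ hz₁U
    obtain ⟨r, hr'⟩ := exists_real_of_im_eq_zero hU (Q.holomorphic φ hφ)
      (pairDiff_holomorphic hf h hφ) hz₁U (mul_ne_zero hz₁ (pow_ne_zero 2 hc1)) (by
        filter_upwards [h1', hU.mem_nhds hz₁U] with w hw hwU
        rw [hQ w hwU, hQ' w hwU, Complex.div_im]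
        simp
        linear_combination -(cfac F w / 2) ^ 2 / Complex.normSq (↑(p w) * ↑(cfac F w) / 2 -
          ↑(q w) * ↑(cfac F w) / 2 * Complex.I) * hw)
    apply hr
    refine ⟨r, fun x => ?_⟩
    rw [← sub_eq_zero]
    refine quadDiff_eq_zero (h := fun x => pairDiff f f' x - r * Q.coeff x) (fun ψ hψ => ?_)
      (p₀ := φ.symm z₁) ?_ x
    · refine ((pairDiff_holomorphic hf h hψ).sub
        ((Q.holomorphic ψ hψ).const_mul (r : ℂ))).congr fun w hw => ?_
      simp only [Pi.sub_apply]
      ring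
    · have hx : φ.symm z₁ ∈ φ.source := φ.map_target hz₁U
      have h4 := (φ.continuousAt hx)
      rw [ContinuousAt, φ.right_inv hz₁U] at h4
      filter_upwards [h4.eventually (hr'.and (hU.eventually_mem hz₁U)),
        φ.open_source.mem_nhds hx] with x hx1 hx2
      have hcx := pow_ne_zero 2 (coordField_ne_zero hφ hx1.2)
      have := hx1.1
      rw [φ.left_inv hx2, ← mul_assoc] at this
      rw [mul_right_cancel₀ hcx this, sub_self]
  -- The umbilic equations are closed conditions, so they pass from `S` to its limit point `z`.
  have closed : ∀ {t : ℂ → E n}, ContDiffOn ℝ ∞ t φ.target → (∀ w ∈ S, t w = 0) → t z = 0 := by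
    intro t ht h0
    by_contra hne
    have := (ContDiffOn.diffAt ht hU hz).continuousAt.eventually_ne hne
    obtain ⟨w, hw, hwS⟩ := mem_closure_iff_nhds.1 hdense _ this
    exact hw (h0 w hwS)
  have sx := ContDiffOn.pd hF.smooth hU 1
  have sy := ContDiffOn.pd hF.smooth hU Complex.I
  have lx := ContDiffOn.pd hF.smooth_logFac hU 1
  have ly := ContDiffOn.pd hF.smooth_logFac hU Complex.I
  constructor
  · rw [← sub_eq_zero]
    exact closed (((ContDiffOn.pd sx hU 1).sub (ContDiffOn.pd sy hU Complex.I)).sub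
      ((lx.smul sx).sub (ly.smul sy))) fun w hw => sub_eq_zero.2 (hSu w hw).diag
  · rw [← sub_eq_zero]
    exact closed (((ContDiffOn.pd sy hU 1).const_smul (2 : ℝ)).sub
      ((ly.smul sx).add (lx.smul sy))) fun w hw => sub_eq_zero.2 (hSu w hw).mixed

theorem mem_of_forall_orthogonal {W : Submodule ℝ (E n)} {x : E n}
    (h : ∀ v ∈ Wᗮ, inner ℝ v x = (0 : ℝ)) : x ∈ W := by
  rw [← W.orthogonal_orthogonal, Submodule.mem_orthogonal]
  exact h

theorem mem_orthogonal_span_range {ι' : Type*} {b : ι' → E n} {v : E n}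
    (hv : v ∈ (Submodule.span ℝ (Set.range b))ᗮ) (i : ι') : inner ℝ v (b i) = (0 : ℝ) := by
  rw [real_inner_comm]
  exact (Submodule.mem_orthogonal _ _).1 hv _ (Submodule.subset_span ⟨i, rfl⟩)

/-- Totally umbilic conformal immersions are plane or spherical. -/
theorem inPlaneOrSphere_of_umbilic [ConnectedSpace M] (hf : IsConformalImmersion f)
    (hu : ∀ φ ∈ atlas ℂ M, ∀ z ∈ φ.target, UmbilicAt (logFac (f ∘ φ.symm)) (f ∘ φ.symm) z) :
    InPlaneOrSphere f := by
  obtain ⟨x₀⟩ := (inferInstance : Nonempty M)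
  have hball : ∀ φ ∈ atlas ℂ M, ∀ (z₀ : ℂ) (r : ℝ), Metric.ball z₀ r ⊆ φ.target →
      ConformalOn (Metric.ball z₀ r) (f ∘ φ.symm) := fun φ hφ z₀ r hB => by
    have hF := hf.conformalOn hφ
    exact ⟨Metric.isOpen_ball, hF.smooth.mono hB, fun z hz => hF.ne_zero z (hB hz),
      fun z hz => hF.norm_eq z (hB hz), fun z hz => hF.inner_eq z (hB hz)⟩
  -- Unique continuation along chart balls: it is enough to find the plane or sphere on one ball
  -- around `x₀`.
  have uc1 : ∀ (v : E n) (b : ℝ), (∀ᶠ x in 𝓝 x₀, inner ℝ v (f x) = b) → ∀ x, inner ℝ v (f x) = b :=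
    fun v b h0 x => forall_of_eventually (P := fun x => inner ℝ v (f x) = b)
      (fun φ hφ z₀ r hB z hz hzP w hw => (hball φ hφ z₀ r hB).inner_eq_of_eventually
        (fun y hy => hu φ hφ y (hB hy)) (convex_ball _ _).isPreconnected hz hzP hw) h0 x
  have uc2 : ∀ (c : E n) (b : ℝ), (∀ᶠ x in 𝓝 x₀, inner ℝ (f x - c) (f x - c) = b) →
      ∀ x, inner ℝ (f x - c) (f x - c) = b :=
    fun c b h0 x => forall_of_eventually (P := fun x => inner ℝ (f x - c) (f x - c) = b)
      (fun φ hφ z₀ r hB z hz hzP w hw => (hball φ hφ z₀ r hB).norm_sub_eq_of_eventually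
        (fun y hy => hu φ hφ y (hB hy)) (convex_ball _ _).isPreconnected hz hzP hw) h0 x
  set φ := chartAt ℂ x₀
  have hφ : φ ∈ atlas ℂ M := chart_mem_atlas ℂ x₀
  obtain ⟨r, hr, hB⟩ := Metric.isOpen_iff.1 φ.open_target (φ x₀) (mem_chart_target ℂ x₀)
  have hF := hball φ hφ _ r hB
  have huF : ∀ z ∈ Metric.ball (φ x₀) r, UmbilicAt (logFac (f ∘ φ.symm)) (f ∘ φ.symm) z :=
    fun y hy => hu φ hφ y (hB hy)
  have hpre := (convex_ball (φ x₀) r).isPreconnected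
  have hz₀ : φ x₀ ∈ Metric.ball (φ x₀) r := Metric.mem_ball_self hr
  have hev : ∀ {P : E n → Prop}, (∀ z ∈ Metric.ball (φ x₀) r, P ((f ∘ φ.symm) z)) →
      ∀ᶠ x in 𝓝 x₀, P (f x) := fun {P} hP => by
    have hx := mem_chart_source ℂ x₀
    filter_upwards [(φ.isOpen_inter_preimage Metric.isOpen_ball).mem_nhds ⟨hx, hz₀⟩] with x hx
    have := hP _ hx.2
    rwa [Function.comp_apply, φ.left_inv hx.1] at this
  have hfx : (f ∘ φ.symm) (φ x₀) = f x₀ := congrArg f (φ.left_inv (mem_chart_source ℂ x₀))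
  set z₀ := φ x₀
  set F := f ∘ φ.symm
  obtain ⟨κ, c, hκ, h1, h2⟩ := hF.exists_lap_eq_sub huF hpre
  have hA := hF.ne_zero z₀ hz₀
  have hAB := hF.inner_eq z₀ hz₀
  have hBA : inner ℝ (pd Complex.I F z₀) (pd 1 F z₀) = (0 : ℝ) := by rw [real_inner_comm, hAB]
  have hB0 : pd Complex.I F z₀ ≠ 0 := fun h0 => by
    have := hF.norm_eq z₀ hz₀
    rw [h0, inner_zero_left] at this
    exact hA (inner_self_eq_zero (𝕜 := ℝ).1 this.symm)
  by_cases h0 : κ = 0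
  · left
    have hli : LinearIndependent ℝ ![pd 1 F z₀, pd Complex.I F z₀] := by
      refine linearIndependent_of_ne_zero_of_inner_eq_zero (𝕜 := ℝ) ?_ ?_
      · intro i; fin_cases i
        exacts [hA, hB0]
      · intro i j hij; fin_cases i <;> fin_cases j <;> simp_all
    -- The tangent plane at `x₀`: for `κ = 0`, a linear function that is critical at one point has
    -- zero energy.
    refine ⟨AffineSubspace.mk' (f x₀)
      (Submodule.span ℝ (Set.range ![pd 1 F z₀, pd Complex.I F z₀])), ?_, fun x => ?_⟩
    · rw [AffineSubspace.direction_mk', finrank_span_eq_card hli, Fintype.card_fin]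
    · rw [AffineSubspace.mem_mk', vsub_eq_sub]
      refine mem_of_forall_orthogonal fun v hv => ?_
      have hv1 : inner ℝ v (pd 1 F z₀) = (0 : ℝ) := mem_orthogonal_span_range hv 0
      have hv2 : inner ℝ v (pd Complex.I F z₀) = (0 : ℝ) := mem_orthogonal_span_range hv 1
      rw [inner_sub_right, sub_eq_zero]
      refine uc1 v _ (hev (P := fun y => inner ℝ v y = (inner ℝ v (f x₀) : ℝ)) fun w hw => ?_) x
      rw [← hfx]
      exact hF.inner_const huF hpre hκ h1 hz₀ hv1 hv2 (by rw [h0, zero_mul]) hw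
  · right
    have hκ' : κ < 0 := lt_of_le_of_ne hκ h0
    obtain ⟨hn0, hCA, hCB⟩ := h2 h0 z₀ hz₀
    have hAC : inner ℝ (pd 1 F z₀) (F z₀ - c) = (0 : ℝ) := by rw [real_inner_comm, hCA]
    have hBC : inner ℝ (pd Complex.I F z₀) (F z₀ - c) = (0 : ℝ) := by rw [real_inner_comm, hCB]
    have hC0 : F z₀ - c ≠ 0 := fun e => by
      rw [e, inner_zero_left, mul_zero] at hn0
      norm_num at hn0
    have hli : LinearIndependent ℝ ![pd 1 F z₀, pd Complex.I F z₀, F z₀ - c] := by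
      refine linearIndependent_of_ne_zero_of_inner_eq_zero (𝕜 := ℝ) ?_ ?_
      · intro i; fin_cases i
        exacts [hA, hB0, hC0]
      · intro i j hij
        fin_cases i <;> fin_cases j <;> first | exact absurd rfl hij | assumption
    have hρ : 0 < -2 / κ := div_pos_of_neg_of_neg (by norm_num) hκ'
    -- For `κ < 0` the potential term of the energy must vanish at `z₀` too, so `v` must also be
    -- orthogonal to `f - c` there. Hence a `3`-space through the centre, spanned by the tangent
    -- plane and the radius.
    refine ⟨AffineSubspace.mk' c
      (Submodule.span ℝ (Set.range ![pd 1 F z₀, pd Complex.I F z₀, F z₀ - c])), c,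
      Real.sqrt (-2 / κ), ?_, AffineSubspace.self_mem_mk' _ _, Real.sqrt_pos.2 hρ,
      fun x => ⟨?_, ?_⟩⟩
    · rw [AffineSubspace.direction_mk', finrank_span_eq_card hli, Fintype.card_fin]
    · rw [AffineSubspace.mem_mk', vsub_eq_sub]
      refine mem_of_forall_orthogonal fun v hv => ?_
      have hv1 : inner ℝ v (pd 1 F z₀) = (0 : ℝ) := mem_orthogonal_span_range hv 0
      have hv2 : inner ℝ v (pd Complex.I F z₀) = (0 : ℝ) := mem_orthogonal_span_range hv 1
      have hv3 : inner ℝ v (F z₀ - c) = (0 : ℝ) := mem_orthogonal_span_range hv 2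
      rw [inner_sub_right, sub_eq_zero]
      refine uc1 v _ (hev (P := fun y => inner ℝ v y = (inner ℝ v c : ℝ)) fun w hw => ?_) x
      rw [inner_sub_right, sub_eq_zero] at hv3
      rw [← hv3]
      exact hF.inner_const huF hpre hκ h1 hz₀ hv1 hv2
        (by rw [inner_sub_right, hv3, sub_self, mul_zero]) hw
    · have := uc2 c (-2 / κ) (hev (P := fun y => inner ℝ (y - c) (y - c) = -2 / κ) fun w hw => by
        rw [eq_div_iff h0, mul_comm]; exact (h2 h0 w hw).1) x
      rw [dist_eq_norm, ← this, real_inner_self_eq_norm_sq, Real.sqrt_sq (norm_nonneg _)]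

theorem exists_pairDiff_eq [ConnectedSpace M] (hf : IsConformalImmersion f)
    (h : IsDarbouxPair ℂ f f') (hc : IsChristoffel Q f fc) (hns : ¬ InPlaneOrSphere f) :
    ∃ r : ℝ, ∀ p, pairDiff f f' p = r * Q.coeff p := by
  by_contra hr
  exact hns (inPlaneOrSphere_of_umbilic hf fun φ hφ z hz =>
    umbilicAt_of_not_proportional hf h hc hr hφ hz)

/-- On the connected `M` a non-constant `f'` has `df' ≠ 0` somewhere, so the condition `r ≠ 0`
follows from the equation. -/
theorem isDarbouxTransform_iff_pairDiff [ConnectedSpace M] (hf : IsConformalImmersion f)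
    (h : IsDarbouxPair ℂ f f') (hc : IsChristoffel Q f fc) (r : ℝ) :
    IsDarbouxTransform Q r f f' ↔ ∀ p, pairDiff f f' p = r * Q.coeff p := by
  refine isDarbouxTransform_iff hf h hc ?_ r
  by_contra hne
  push Not at hne
  obtain ⟨p, q, hpq⟩ := h.nonConst'
  exact hpq (const_of_dC_eq_zero h.smooth' hne p q)

/-- Uniqueness is read off at a single point where `Q` does not vanish. -/
theorem existsUnique_isDarbouxTransform [ConnectedSpace M] (hf : IsConformalImmersion f)
    (h : IsDarbouxPair ℂ f f') (hc : IsChristoffel Q f fc) (hns : ¬ InPlaneOrSphere f) :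
    ∃! r : ℝ, IsDarbouxTransform Q r f f' := by
  obtain ⟨r, hr⟩ := exists_pairDiff_eq hf h hc hns
  refine ⟨r, (isDarbouxTransform_iff_pairDiff hf h hc r).2 hr, fun s hs => ?_⟩
  obtain ⟨p, hp⟩ := Q.ne_zero
  have h1 := (isDarbouxTransform_iff_pairDiff hf h hc s).1 hs p
  rw [hr p] at h1
  exact (Complex.ofReal_injective (mul_right_cancel₀ hp h1)).symm

end Global

end DarbouxFrames

theorem mainTheorem12 (n : ℕ) :
    (∀ (T : Type u) [NormedAddCommGroup T] [NormedSpace ℝ T] [FiniteDimensional ℝ T]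
      (M : Type v) [TopologicalSpace M] [ChartedSpace T M] [IsManifold 𝓘(ℝ, T) ∞ M]
      (f f' : M → E n) (F : M → Mat n),
      Smooth T f → Smooth T f' → NonConst f → NonConst f' → IsFrame T F f f' →
      (∀ p X, maurerCartan T F p X 0 1 ∈ Set.range (ι n) ∧
        maurerCartan T F p X 1 0 ∈ Set.range (ι n)) ∧
      (IsDarbouxPair T f f' ↔
        WedgeZero (T := T) (fun p X => maurerCartan T F p X 0 1)
          (fun p X => maurerCartan T F p X 1 0))) ∧
    (∀ (M : Type w) [TopologicalSpace M] [T2Space M] [ConnectedSpace M]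
      [ChartedSpace ℂ M] [IsManifold 𝓘(ℂ, ℂ) ω M] (Q : Polarisation M)
      (f f' : M → E n) (F : M → Mat n),
      IsFrame ℂ F f f' → IsDarbouxPair ℂ f f' → IsIsothermic Q f →
      (∀ r : ℝ, IsDarbouxTransform Q r f f' ↔
        ∀ p, twoZero (fun q X => toVec n (maurerCartan ℂ F q X 0 1))
          (fun q X => toVec n (maurerCartan ℂ F q X 1 0)) p = -(r : ℂ) * Q.coeff p) ∧
      (¬ InPlaneOrSphere f → ∃! r : ℝ, IsDarbouxTransform Q r f f')) := by
  refine ⟨fun T _ _ _ M _ _ _ f f' F hf hf' hc hc' hF => ⟨hF.mem_range hf hf',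
    hF.isDarbouxPair_iff hf hf' hc hc'⟩, ?_⟩
  rintro M _ _ _ _ _ Q f f' F hF h ⟨hf, fc, hfc⟩
  refine ⟨fun r => ?_, existsUnique_isDarbouxTransform hf h hfc⟩
  rw [isDarbouxTransform_iff_pairDiff hf h hfc]
  refine forall_congr' fun p => ?_
  rw [hF.twoZero_eq hf.smooth h.smooth', neg_mul, neg_inj]
  rfl
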